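/- Let $W\in\mathbb{R}^{\ell\times n}$ have rows $w_1,\dots,w_\ell$. For nonzero $x,y\in\mathbb{R}^n$ put $\hat x=x/\|x\|_2$, $\hat y=y/\|y\|_2$, let $\theta\in[0,\pi]$ be the angle between $x$ and $y$, let $M_{\hat x\leftrightarrow\hat y}\in\mathbb{R}^{n\times n}$ be the matrix with $M\hat x=\hat y$, $M\hat y=\hat x$ and $Mz=0$ for all $z\in\mathrm{span}(x,y)^\perp$, and let $$Q_{x,y}=\frac{\pi-\theta}{2\pi}I_n+\frac{\sin\theta}{2\pi}M_{\hat x\leftrightarrow\hat y}.$$ We say that $W$ satisfies the Weight Distribution Condition (WDC) with constants $\epsilon>0$ and $0<\alpha\le 1$ if for all nonzero $x,y\in\mathbb{R}^n$, in the spectral norm, $$\Big\|\sum_{i=1}^{\ell}\mathbf 1_{w_i\cdot x>0}\,\mathbf 1_{w_i\cdot y>0}\;w_iw_i^{\top}-\alpha\,Q_{x,y}\Big\|\le\epsilon .$$ **Lemma.** There are absolute constants $C>0$ and $k\in\mathbb{N}$, $k\ge 1$, such that for every $0<\epsilon<1$ there are $c,\gamma>0$, depending only on $\epsilon$, with $c\le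 C\epsilon^{-k}$ and $\gamma^{-1}\le C\epsilon^{-k}$, for which the following holds. Let $n\ge 1$ and $\ell\ge 0$ be integers with $\ell>c\,n\log n$. Let $g_1,\dots,g_\ell$ be independent random vectors with law $\mathcal N(0,\tfrac1\ell I_n)$, and let $W\in\mathbb{R}^{\ell\times n}$ be the random matrix whose $i$th row is $w_i=g_i\cdot\mathbf 1_{\|g_i\|_2\le 3\sqrt{n/\ell}}$ (that is, $g_i$ if $\|g_i\|_2\le 3\sqrt{n/\ell}$, and $0$ otherwise). Then, on an event of probability at least $1-8n\,e^{-\gamma n}$, $W$ satisfies the WDC with constants $\epsilon$ and $$\alpha=\frac{\Gamma\left(\frac{n+2}{2}\right)-\Gamma\left(\frac{n+2}{2},\frac{9n}{2}\right)}{\Gamma\left(\frac{n+2}{2}\right)},$$ where $\Gamma(s)$ is the Gamma function and $\Gamma(s,a)=\int_a^\infty t^{s-1}e^{-t}\,dt$ is the upper incomplete Gamma function. -/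

import Mathlib

open MeasureTheory ProbabilityTheory

noncomputable section

/-- The unit vector in the direction of a nonzero vector `x`. -/
def unitVec {n : ℕ} (x : EuclideanSpace ℝ (Fin n)) : EuclideanSpace ℝ (Fin n) :=
  ‖x‖⁻¹ • x

/-- The matrix `v vᵀ / ‖v‖²` of the orthogonal projection onto the line spanned by `v`
(the zero matrix if `v = 0`). -/
def lineProj {n : ℕ} (v : EuclideanSpace ℝ (Fin n)) : Matrix (Fin n) (Fin n) ℝ :=
  (‖v‖ ^ 2)⁻¹ • Matrix.vecMulVec v.ofLp v.ofLp

/-- For nonzero `x`, `y` with directions `x̂`, `ŷ`: the matrix that sends `x̂` to `ŷ`, `ŷ` to `x̂`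
and every vector orthogonal to `x` and `y` to `0`. It is the projection onto the line of
`x̂ + ŷ` minus the projection onto the line of `x̂ - ŷ`; the defining properties are proved in
`swapMatrix_mulVec_left`, `swapMatrix_mulVec_right`, `swapMatrix_mulVec_orthogonal`. -/
def swapMatrix {n : ℕ} (x y : EuclideanSpace ℝ (Fin n)) : Matrix (Fin n) (Fin n) ℝ :=
  lineProj (unitVec x + unitVec y) - lineProj (unitVec x - unitVec y)

/-- `Q_{x,y} = (π - θ)/(2π) I + (sin θ)/(2π) M_{x̂ ↔ ŷ}`, where `θ` is the angle of `x` and `y`. -/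
def QMatrix {n : ℕ} (x y : EuclideanSpace ℝ (Fin n)) : Matrix (Fin n) (Fin n) ℝ :=
  ((Real.pi - InnerProductGeometry.angle x y) / (2 * Real.pi)) • (1 : Matrix (Fin n) (Fin n) ℝ)
    + (Real.sin (InnerProductGeometry.angle x y) / (2 * Real.pi)) • swapMatrix x y

/-- `∑ i, 1_{wᵢ · x > 0} 1_{wᵢ · y > 0} wᵢ wᵢᵀ`, where `wᵢ` is the `i`th row of `W`. -/
def activeGram {ℓ n : ℕ} (W : Matrix (Fin ℓ) (Fin n) ℝ) (x y : EuclideanSpace ℝ (Fin n)) :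
    Matrix (Fin n) (Fin n) ℝ :=
  ∑ i : Fin ℓ,
    (if 0 < W i ⬝ᵥ x.ofLp then (1 : ℝ) else 0) •
      (if 0 < W i ⬝ᵥ y.ofLp then (1 : ℝ) else 0) • Matrix.vecMulVec (W i) (W i)

/-- The Weight Distribution Condition with constants `ε > 0` and `0 < α ≤ 1`. The norm is the
spectral norm, that is, the operator norm for the Euclidean norms. -/
def WDC {ℓ n : ℕ} (W : Matrix (Fin ℓ) (Fin n) ℝ) (ε α : ℝ) : Prop :=
  0 < ε ∧ 0 < α ∧ α ≤ 1 ∧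
    ∀ x y : EuclideanSpace ℝ (Fin n), x ≠ 0 → y ≠ 0 →
      ‖Matrix.toEuclideanCLM (n := Fin n) (𝕜 := ℝ) (activeGram W x y - α • QMatrix x y)‖ ≤ ε

/-- The upper incomplete Gamma function `Γ(s, a) = ∫_a^∞ t^(s-1) e^(-t) dt`. -/
def upperGamma (s a : ℝ) : ℝ :=
  ∫ t in Set.Ioi a, t ^ (s - 1) * Real.exp (-t)

/-- `α = (Γ((n+2)/2) - Γ((n+2)/2, 9n/2)) / Γ((n+2)/2)`. -/
def truncAlpha (n : ℕ) : ℝ :=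
  (Real.Gamma (((n : ℝ) + 2) / 2) - upperGamma (((n : ℝ) + 2) / 2) (9 * (n : ℝ) / 2)) /
    Real.Gamma (((n : ℝ) + 2) / 2)

/-- The truncation `w · 1_{‖w‖ ≤ R}`: the vector `w` if `‖w‖ ≤ R`, and `0` otherwise. -/
def truncVec {n : ℕ} (R : ℝ) (w : EuclideanSpace ℝ (Fin n)) : EuclideanSpace ℝ (Fin n) :=
  Set.indicator {v | ‖v‖ ≤ R} (fun v => v) w

/-- The `ℓ × n` matrix whose `i`th row is `wᵢ · 1_{‖wᵢ‖ ≤ 3 √(n/ℓ)}`. -/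
def truncMatrix {ℓ n : ℕ} (w : Fin ℓ → EuclideanSpace ℝ (Fin n)) : Matrix (Fin ℓ) (Fin n) ℝ :=
  Matrix.of fun i => (truncVec (3 * Real.sqrt ((n : ℝ) / (ℓ : ℝ))) (w i)).ofLp

theorem lineProj_mulVec {n : ℕ} (v z : EuclideanSpace ℝ (Fin n)) :
    (lineProj v).mulVec z.ofLp = ((‖v‖ ^ 2)⁻¹ * inner ℝ v z) • v.ofLp := by
  have h : inner ℝ v z = v.ofLp ⬝ᵥ z.ofLp := by
    simp [PiLp.inner_apply, dotProduct, mul_comm]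
  ext i
  simp only [lineProj, Matrix.smul_mulVec, Matrix.vecMulVec_mulVec, h, Pi.smul_apply, smul_eq_mul,
    MulOpposite.smul_eq_mul_unop, MulOpposite.unop_op]
  ring

theorem lineProj_mulVec_self {n : ℕ} (v : EuclideanSpace ℝ (Fin n)) :
    (lineProj v).mulVec v.ofLp = v.ofLp := by
  rw [lineProj_mulVec, real_inner_self_eq_norm_sq]
  by_cases hv : v = 0
  · simp [hv]
  · rw [inv_mul_cancel₀ (by simpa using hv), one_smul]

theorem lineProj_mulVec_of_inner_eq_zero {n : ℕ} {v z : EuclideanSpace ℝ (Fin n)}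
    (h : inner ℝ v z = 0) : (lineProj v).mulVec z.ofLp = 0 := by
  rw [lineProj_mulVec, h, mul_zero, zero_smul]

theorem norm_unitVec {n : ℕ} {x : EuclideanSpace ℝ (Fin n)} (hx : x ≠ 0) : ‖unitVec x‖ = 1 := by
  simp [unitVec, norm_smul, hx]

theorem swapMatrix_comm {n : ℕ} (x y : EuclideanSpace ℝ (Fin n)) :
    swapMatrix x y = swapMatrix y x := by
  have h : unitVec y - unitVec x = -(unitVec x - unitVec y) := by abel
  have h2 : ∀ v : EuclideanSpace ℝ (Fin n), lineProj (-v) = lineProj v := by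
    intro v
    simp [lineProj, Matrix.neg_vecMulVec, Matrix.vecMulVec_neg]
  rw [swapMatrix, swapMatrix, h, h2, add_comm (unitVec y)]

theorem swapMatrix_mulVec_left {n : ℕ} {x y : EuclideanSpace ℝ (Fin n)} (hx : x ≠ 0)
    (hy : y ≠ 0) : (swapMatrix x y).mulVec (unitVec x).ofLp = (unitVec y).ofLp := by
  set a := unitVec x with ha
  set b := unitVec y with hb
  have hab : inner ℝ (a + b) (a - b) = 0 := by
    rw [real_inner_add_sub_eq_zero_iff, ha, hb, norm_unitVec hx, norm_unitVec hy]
  have hba : inner ℝ (a - b) (a + b) = 0 := by rw [real_inner_comm]; exact hab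
  have hsplit : a.ofLp = (1 / 2 : ℝ) • ((a + b).ofLp + (a - b).ofLp) := by
    ext i; simp; ring
  rw [hsplit, Matrix.mulVec_smul, Matrix.mulVec_add, swapMatrix, ← ha, ← hb,
    Matrix.sub_mulVec, Matrix.sub_mulVec, lineProj_mulVec_self, lineProj_mulVec_self,
    lineProj_mulVec_of_inner_eq_zero hab, lineProj_mulVec_of_inner_eq_zero hba]
  ext i; simp; ring

theorem swapMatrix_mulVec_right {n : ℕ} {x y : EuclideanSpace ℝ (Fin n)} (hx : x ≠ 0)
    (hy : y ≠ 0) : (swapMatrix x y).mulVec (unitVec y).ofLp = (unitVec x).ofLp := by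
  rw [swapMatrix_comm]
  exact swapMatrix_mulVec_left hy hx

theorem swapMatrix_mulVec_orthogonal {n : ℕ} {x y z : EuclideanSpace ℝ (Fin n)}
    (hx : inner ℝ x z = 0) (hy : inner ℝ y z = 0) : (swapMatrix x y).mulVec z.ofLp = 0 := by
  have h1 : inner ℝ (unitVec x) z = 0 := by simp [unitVec, inner_smul_left, hx]
  have h2 : inner ℝ (unitVec y) z = 0 := by simp [unitVec, inner_smul_left, hy]
  rw [swapMatrix, Matrix.sub_mulVec,
    lineProj_mulVec_of_inner_eq_zero (by rw [inner_add_left, h1, h2, add_zero]),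
    lineProj_mulVec_of_inner_eq_zero (by rw [inner_sub_left, h1, h2, sub_zero]), sub_zero]

end

/-! Put `g i = √ℓ • w i`, which is standard Gaussian. For unit vectors, `ℓ` times the quadratic form
of the Gram matrix at `u` is the sum of the independent variables `coneSq (3√n) 0 x y u (g i)`, and
the matrices are symmetric, so the spectral norm is controlled by these forms.

The mean is exact. The function `1_{x·g>0} 1_{y·g>0} (u·g)²` is positively homogeneous of degree
two, so in polar coordinates truncation at `3√n` affects only the radial integral; with `t = r²/2`
it contributes precisely the factor `truncAlpha n` (`integral_homogeneous_truncated`). The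
untruncated integral reduces to the plane of `x` and `y` plus one independent direction, and
integration over a planar sector gives the quadratic form of `QMatrix` (`integral_cone_sq`).

For fixed `x, y, u` each summand lies between `0` and a squared standard Gaussian, so a Bernstein
bound holds (`measureReal_abs_sum_sub_ge_le`). Uniformity comes from a net of mesh of order `ε²/n`.
The indicators are discontinuous, but a truncated vector changes its inner product with a nearby
direction by at most `Rδ`, where `R = 3√n`. The sum is therefore sandwiched between sums at net
points with the thresholds `τ = ±Rδ` (`coneSq_sandwich`). Their means differ little, because a thin
slab carries little second moment (`integral_coneSq_gap_le`).

The net has at most `exp (5 n log n)` points in the relevant range. This is where `ℓ > c n log n` is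
used: the Bernstein exponent beats a union bound over triples of net points. If `γ n ≤ 1`, the
probability bound is vacuous. -/

/-! ### Density and one-dimensional marginals of the standard Gaussian -/

theorem stdGaussian_eq_withDensity {n : ℕ} :
    stdGaussian (EuclideanSpace ℝ (Fin n)) =
      (volume : Measure (EuclideanSpace ℝ (Fin n))).withDensity fun x =>
        ENNReal.ofReal ((2 * Real.pi) ^ (-(n : ℝ) / 2) * Real.exp (-‖x‖ ^ 2 / 2)) := by
  have hint : Integrable (fun x : EuclideanSpace ℝ (Fin n) =>
      (2 * Real.pi) ^ (-(n : ℝ) / 2) * Real.exp (-‖x‖ ^ 2 / 2)) := by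
    refine Integrable.const_mul ?_ _
    have h := GaussianFourier.integral_rexp_neg_mul_sq_norm
      (V := EuclideanSpace ℝ (Fin n)) (b := 1 / 2) (by norm_num)
    refine (Integrable.of_integral_ne_zero (h.trans_ne (by positivity))).congr ?_
    exact .of_forall fun x => by ring_nf
  have hfin : IsFiniteMeasure ((volume : Measure (EuclideanSpace ℝ (Fin n))).withDensity fun x =>
        ENNReal.ofReal ((2 * Real.pi) ^ (-(n : ℝ) / 2) * Real.exp (-‖x‖ ^ 2 / 2))) :=
    isFiniteMeasure_withDensity_ofReal hint.2
  refine Measure.ext_of_charFun ?_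
  ext t
  rw [charFun_stdGaussian, charFun_apply, integral_withDensity_eq_integral_toReal_smul
    (by fun_prop) (by simp)]
  have h := GaussianFourier.integral_cexp_neg_mul_sq_norm_add
    (V := EuclideanSpace ℝ (Fin n)) (b := 1 / 2) (by norm_num) Complex.I t
  have hc : ∀ v : EuclideanSpace ℝ (Fin n),
      (ENNReal.ofReal ((2 * Real.pi) ^ (-(n : ℝ) / 2) * Real.exp (-‖v‖ ^ 2 / 2))).toReal •
        Complex.exp (inner ℝ v t * Complex.I) =
      ((2 * Real.pi) ^ (-(n : ℝ) / 2) : ℝ) *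
        Complex.exp (-(1 / 2) * ‖v‖ ^ 2 + Complex.I * inner ℝ t v) := by
    intro v
    rw [ENNReal.toReal_ofReal (by positivity), Complex.real_smul, Complex.exp_add,
      real_inner_comm]
    push_cast
    rw [mul_assoc]
    congr 3 <;> ring_nf
  simp_rw [hc]
  rw [integral_const_mul, h, ← mul_assoc]
  have h1 : ((Real.pi : ℂ) / (1 / 2)) ^ ((Module.finrank ℝ (EuclideanSpace ℝ (Fin n)) : ℂ) / 2) =
      (((2 * Real.pi) ^ ((n : ℝ) / 2) : ℝ) : ℂ) := by
    rw [Complex.ofReal_cpow (by positivity)]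
    push_cast
    rw [finrank_euclideanSpace_fin]
    congr 1
    ring
  rw [h1, ← Complex.ofReal_mul, ← Real.rpow_add (by positivity)]
  rw [show -(n : ℝ) / 2 + n / 2 = 0 by ring, Real.rpow_zero, Complex.ofReal_one, one_mul]
  congr 1
  rw [Complex.I_sq]
  ring

theorem hasLaw_inner_stdGaussian {n : ℕ} {v : EuclideanSpace ℝ (Fin n)} (hv : ‖v‖ = 1) :
    HasLaw (fun g => inner ℝ v g) (gaussianReal 0 1)
      (stdGaussian (EuclideanSpace ℝ (Fin n))) where
  aemeasurable := by fun_prop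
  map_eq := by
    refine Measure.ext_of_charFun ?_
    ext t
    have h := charFun_stdGaussian (t • v)
    rw [charFun_apply] at h
    rw [charFun_apply, integral_map (by fun_prop) (by fun_prop), charFun_gaussianReal]
    convert h using 1
    · congr! 3 with g
      rw [real_inner_smul_right, real_inner_comm v]
      simp [mul_comm]
    · simp [norm_smul, hv, ← Complex.ofReal_pow, sq_abs, neg_div]

/-- The joint characteristic function is `exp (-‖∑ tᵢ vᵢ‖² / 2)`, and orthonormality turns the
squared norm into `∑ tᵢ²`, so it factors. -/
theorem iIndepFun_inner_of_orthonormal {n : ℕ} {ι : Type*} [Fintype ι]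
    {v : ι → EuclideanSpace ℝ (Fin n)} (hv : Orthonormal ℝ v) :
    iIndepFun (fun i g => inner ℝ (v i) g) (stdGaussian (EuclideanSpace ℝ (Fin n))) := by
  rw [iIndepFun_iff_charFun_pi (by fun_prop)]
  intro t
  have hr : ∀ i, charFun ((stdGaussian (EuclideanSpace ℝ (Fin n))).map
      fun g => inner ℝ (v i) g) (t i) = Complex.exp (-(t i) ^ 2 / 2) := fun i => by
    rw [(hasLaw_inner_stdGaussian (hv.1 i)).map_eq, charFun_gaussianReal]
    simp [neg_div]
  simp_rw [hr]
  have h := charFun_stdGaussian (∑ i, t i • v i)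
  rw [charFun_apply] at h
  rw [charFun_apply, integral_map (by fun_prop) (by fun_prop), ← Complex.exp_sum]
  have h2 : ‖∑ i, t i • v i‖ ^ 2 = ∑ i, t i ^ 2 := by
    rw [← real_inner_self_eq_norm_sq, hv.inner_sum]
    simp [sq]
  rw [← Complex.ofReal_pow, h2] at h
  convert h using 3 with g
  · rw [inner_sum]
    simp only [PiLp.inner_apply (𝕜 := ℝ) (_ : WithLp 2 (ι → ℝ)) _, real_inner_smul_right,
      real_inner_comm g]
    simp [mul_comm]
  · push_cast
    rw [← Finset.sum_neg_distrib, Finset.sum_div]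

/-! ### Radial integration and the truncation factor -/

/-- Polar coordinates for a positively homogeneous function of degree two. -/
theorem integral_homogeneous_mul_norm {n : ℕ} [NeZero n] {f : EuclideanSpace ℝ (Fin n) → ℝ}
    (hf : ∀ (r : ℝ) x, 0 < r → f (r • x) = r ^ 2 * f x) (h : ℝ → ℝ) :
    ∫ x, f x * h ‖x‖ =
      (∫ x : Metric.sphere (0 : EuclideanSpace ℝ (Fin n)) 1, f x ∂(volume.toSphere)) *
        ∫ r in Set.Ioi (0 : ℝ), r ^ (n + 1) * h r := by
  -- The radial measure has density `r ^ (n - 1)`, and homogeneity contributes `r ^ 2`; `n ≥ 1`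
  -- makes the natural subtraction exact.
  have hn : n - 1 + 2 = n + 1 := by have := NeZero.pos n; omega
  calc ∫ x, f x * h ‖x‖
      = ∫ x : ({(0)}ᶜ : Set (EuclideanSpace ℝ (Fin n))), f x * h ‖x.1‖ ∂(volume.comap Subtype.val) := by
        rw [integral_subtype_comap (measurableSet_singleton _).compl fun x => f x * h ‖x‖,
          restrict_compl_singleton]
    _ = ∫ x : Metric.sphere (0 : EuclideanSpace ℝ (Fin n)) 1 × Set.Ioi (0 : ℝ),
          f x.1.1 * (x.2.1 ^ 2 * h x.2.1)
          ∂(volume.toSphere.prod (.volumeIoiPow (n - 1))) := by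
        have key := (volume : Measure
          (EuclideanSpace ℝ (Fin n))).measurePreserving_homeomorphUnitSphereProd.integral_comp
          (Homeomorph.measurableEmbedding _) fun x => f x.1.1 * (x.2.1 ^ 2 * h x.2.1)
        rw [finrank_euclideanSpace_fin] at key
        rw [← key]
        refine integral_congr_ae (.of_forall fun x => ?_)
        have hx : 0 < ‖x.1‖ := norm_pos_iff.2 x.2
        simp only [homeomorphUnitSphereProd_apply_snd_coe, homeomorphUnitSphereProd_apply_fst_coe]
        rw [hf _ _ (inv_pos.2 hx)]
        field_simp
    _ = _ := by
        rw [integral_prod_mul (fun x : Metric.sphere (0 : EuclideanSpace ℝ (Fin n)) 1 => f x)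
          (fun r : Set.Ioi (0 : ℝ) => r.1 ^ 2 * h r.1)]
        congr 1
        simp only [Measure.volumeIoiPow, ENNReal.ofReal]
        rw [integral_withDensity_eq_integral_smul (by fun_prop),
          integral_subtype_comap measurableSet_Ioi
            fun r => Real.toNNReal (r ^ (n - 1)) • (r ^ 2 * h r)]
        refine setIntegral_congr_fun measurableSet_Ioi fun r hr => ?_
        simp only [NNReal.smul_def, Real.coe_toNNReal _ (pow_nonneg (le_of_lt hr) _), smul_eq_mul]
        rw [← mul_assoc, ← pow_add, hn]

/-- The substitution `t = r² / 2`. -/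
theorem integral_pow_mul_exp_neg_sq (n : ℕ) (φ : ℝ → ℝ) :
    ∫ r in Set.Ioi (0 : ℝ), r ^ (n + 1) * (φ (r ^ 2 / 2) * Real.exp (-r ^ 2 / 2)) =
      2 ^ ((n : ℝ) / 2) * ∫ t in Set.Ioi (0 : ℝ), φ t * (t ^ ((n : ℝ) / 2) * Real.exp (-t)) := by
  have h1 := integral_comp_rpow_Ioi_of_pos (E := ℝ)
    (g := fun s => φ (s / 2) * ((s / 2) ^ ((n : ℝ) / 2) * Real.exp (-(s / 2)))) (p := 2) two_pos
  have h2 := integral_comp_mul_left_Ioi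
    (fun t => φ t * (t ^ ((n : ℝ) / 2) * Real.exp (-t))) 0 (b := 1 / 2) (by norm_num)
  simp only [mul_zero, one_div, inv_inv, smul_eq_mul] at h1 h2
  simp_rw [inv_mul_eq_div] at h2
  rw [h2, ← mul_right_inj' (Real.rpow_pos_of_pos two_pos ((n : ℝ) / 2)).ne'] at h1
  rw [← mul_right_inj' (two_ne_zero (α := ℝ)), mul_left_comm, ← h1, ← integral_const_mul,
    ← integral_const_mul]
  refine setIntegral_congr_fun measurableSet_Ioi fun r hr => ?_
  have hr0 : (0 : ℝ) ≤ r := le_of_lt hr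
  have e1 : (2 : ℝ) ^ ((n : ℝ) / 2) * (r ^ 2 / 2) ^ ((n : ℝ) / 2) = r ^ n := by
    rw [← Real.mul_rpow zero_le_two (by positivity), mul_div_cancel₀ _ two_ne_zero,
      ← Real.rpow_natCast r 2, ← Real.rpow_mul hr0, ← Real.rpow_natCast]
    congr 1
    push_cast
    ring
  simp only [Real.rpow_two, show (2 : ℝ) - 1 = 1 by norm_num, Real.rpow_one]
  rw [pow_succ, ← e1, neg_div]
  ring

theorem upperGamma_integrableOn {s : ℝ} (hs : 0 < s) :
    IntegrableOn (fun t : ℝ => t ^ (s - 1) * Real.exp (-t)) (Set.Ioi 0) :=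
  (Real.GammaIntegral_convergent hs).congr (.of_forall fun _ => mul_comm _ _)

theorem gamma_sub_upperGamma {s a : ℝ} (hs : 0 < s) (ha : 0 ≤ a) :
    Real.Gamma s - upperGamma s a = ∫ t in Set.Ioc 0 a, t ^ (s - 1) * Real.exp (-t) := by
  have h : Real.Gamma s = ∫ t in Set.Ioi 0, t ^ (s - 1) * Real.exp (-t) := by
    rw [Real.Gamma_eq_integral hs]
    simp_rw [mul_comm]
  have hi := upperGamma_integrableOn hs
  rw [upperGamma, h, ← Set.Ioc_union_Ioi_eq_Ioi ha, setIntegral_union Set.Ioc_disjoint_Ioi_same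
    measurableSet_Ioi (hi.mono_set Set.Ioc_subset_Ioi_self) (hi.mono_set (Set.Ioi_subset_Ioi ha)),
    add_sub_cancel_right]

theorem truncAlpha_pos {n : ℕ} (hn : 1 ≤ n) : 0 < truncAlpha n := by
  have hn' : (1 : ℝ) ≤ n := by exact_mod_cast hn
  have hs : (0 : ℝ) < ((n : ℝ) + 2) / 2 := by positivity
  refine div_pos ?_ (Real.Gamma_pos_of_pos hs)
  rw [gamma_sub_upperGamma hs (by positivity), ← intervalIntegral.integral_of_le (by positivity)]
  refine intervalIntegral.intervalIntegral_pos_of_pos_on ?_ (fun t ht => ?_) (by positivity)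
  · rw [intervalIntegrable_iff_integrableOn_Ioc_of_le (by positivity)]
    exact (upperGamma_integrableOn hs).mono_set Set.Ioc_subset_Ioi_self
  · have := ht.1
    positivity

theorem truncAlpha_le_one {n : ℕ} : truncAlpha n ≤ 1 := by
  have hs : (0 : ℝ) < ((n : ℝ) + 2) / 2 := by positivity
  refine div_le_one_of_le₀ ?_ (Real.Gamma_pos_of_pos hs).le
  rw [sub_le_self_iff]
  refine setIntegral_nonneg measurableSet_Ioi fun t ht => ?_
  have : 0 < t := lt_of_le_of_lt (by positivity) ht
  positivity

/-- `truncAlpha n` is the ratio of two radial integrals, with weights the indicator of `t ≤ 9n/2`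
and `1`; in the variable `t = r²/2` this cutoff is `r ≤ 3√n`. -/
theorem truncAlpha_mul_integral (n : ℕ) :
    truncAlpha n * ∫ t in Set.Ioi (0 : ℝ), t ^ ((n : ℝ) / 2) * Real.exp (-t) =
      ∫ t in Set.Ioi (0 : ℝ),
        (Set.Iic (9 * (n : ℝ) / 2)).indicator 1 t * (t ^ ((n : ℝ) / 2) * Real.exp (-t)) := by
  have hs : (0 : ℝ) < ((n : ℝ) + 2) / 2 := by positivity
  have he : ((n : ℝ) + 2) / 2 - 1 = (n : ℝ) / 2 := by ring
  have h : Real.Gamma (((n : ℝ) + 2) / 2) =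
      ∫ t in Set.Ioi 0, t ^ ((n : ℝ) / 2) * Real.exp (-t) := by
    rw [Real.Gamma_eq_integral hs, he]
    simp_rw [mul_comm]
  rw [← h, truncAlpha, div_mul_cancel₀ _ (Real.Gamma_pos_of_pos hs).ne',
    gamma_sub_upperGamma hs (by positivity), he, ← Set.Ioi_inter_Iic,
    ← setIntegral_indicator measurableSet_Iic]
  refine integral_congr_ae (.of_forall fun t => ?_)
  by_cases ht : t ∈ Set.Iic (9 * (n : ℝ) / 2) <;> simp [ht]

/-- Truncation at radius `3 √n` multiplies the Gaussian integral of a positively homogeneous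
function of degree two by `truncAlpha n`. -/
theorem integral_homogeneous_truncated {n : ℕ} [NeZero n] {f : EuclideanSpace ℝ (Fin n) → ℝ}
    (hf : ∀ (r : ℝ) x, 0 < r → f (r • x) = r ^ 2 * f x) :
    ∫ g in {g | ‖g‖ ≤ 3 * Real.sqrt n}, f g ∂(stdGaussian (EuclideanSpace ℝ (Fin n))) =
      truncAlpha n * ∫ g, f g ∂(stdGaussian (EuclideanSpace ℝ (Fin n))) := by
  have hm : MeasurableSet {g : EuclideanSpace ℝ (Fin n) | ‖g‖ ≤ 3 * Real.sqrt n} :=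
    measurableSet_le (by fun_prop) (by fun_prop)
  -- The spherical factor does not depend on the radial weight `φ`, so the weights `1` and the
  -- indicator of the cutoff give integrals that differ only in the radial factor.
  have key : ∀ φ : ℝ → ℝ, ∫ g, f g * φ (‖g‖ ^ 2 / 2) ∂(stdGaussian (EuclideanSpace ℝ (Fin n))) =
      (2 * Real.pi) ^ (-(n : ℝ) / 2) *
      (∫ x : Metric.sphere (0 : EuclideanSpace ℝ (Fin n)) 1, f x ∂(volume.toSphere)) *
        (2 ^ ((n : ℝ) / 2) *
          ∫ t in Set.Ioi (0 : ℝ), φ t * (t ^ ((n : ℝ) / 2) * Real.exp (-t))) := by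
    intro φ
    rw [← integral_pow_mul_exp_neg_sq, mul_assoc, ← integral_homogeneous_mul_norm hf
      fun r => φ (r ^ 2 / 2) * Real.exp (-r ^ 2 / 2), stdGaussian_eq_withDensity,
      integral_withDensity_eq_integral_toReal_smul (by fun_prop) (by simp), ← integral_const_mul]
    refine integral_congr_ae (.of_forall fun x => ?_)
    simp only [smul_eq_mul]
    rw [ENNReal.toReal_ofReal (by positivity)]
    ring
  have h1 := key 1
  have h2 := key ((Set.Iic (9 * (n : ℝ) / 2)).indicator 1)
  rw [← truncAlpha_mul_integral] at h2
  simp only [Pi.one_apply, mul_one, one_mul] at h1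
  rw [← integral_indicator hm, h1]
  calc _ = _ := integral_congr_ae (.of_forall fun g => ?_)
    _ = _ := h2
    _ = _ := by ring
  have hiff : ‖g‖ ≤ 3 * Real.sqrt n ↔ ‖g‖ ^ 2 / 2 ≤ 9 * (n : ℝ) / 2 := by
    rw [← abs_of_nonneg (norm_nonneg g), ← abs_of_nonneg (by positivity : 0 ≤ 3 * Real.sqrt n),
      ← sq_le_sq, mul_pow, Real.sq_sqrt (by positivity)]
    simp only [sq_abs]
    constructor <;> intro h <;> linarith
  by_cases hg : ‖g‖ ≤ 3 * Real.sqrt n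
  · simp [Set.indicator_of_mem (show g ∈ {g | ‖g‖ ≤ 3 * Real.sqrt n} from hg), hiff.1 hg]
  · simp [Set.indicator_of_notMem (show g ∉ {g | ‖g‖ ≤ 3 * Real.sqrt n} from hg),
      Set.indicator_of_notMem (show ‖g‖ ^ 2 / 2 ∉ Set.Iic (9 * (n : ℝ) / 2) from
        fun h => hg (hiff.2 h))]

/-! ### Second moments of a Gaussian on a planar sector -/

/-- Polar coordinates for the planar Gaussian integral of a positively homogeneous function. -/
theorem integral_gaussianReal_prod_homogeneous {k : ℕ} {F : ℝ × ℝ → ℝ}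
    (hF : ∀ (r : ℝ) p, 0 < r → F (r • p) = r ^ k * F p) :
    ∫ p, F p ∂((gaussianReal 0 1).prod (gaussianReal 0 1)) =
      2 ^ ((k : ℝ) / 2) * Real.Gamma ((k : ℝ) / 2 + 1) / (2 * Real.pi) *
        ∫ φ in Set.Ioo (-Real.pi) Real.pi, F (Real.cos φ, Real.sin φ) := by
  have hd : ∀ p : ℝ × ℝ, (gaussianPDF 0 1 p.1 * gaussianPDF 0 1 p.2).toReal =
      (2 * Real.pi)⁻¹ * Real.exp (-(p.1 ^ 2 + p.2 ^ 2) / 2) := by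
    intro p
    rw [ENNReal.toReal_mul, toReal_gaussianPDF, toReal_gaussianPDF, gaussianPDFReal_def]
    simp only [NNReal.coe_one, mul_one, sub_zero]
    rw [mul_mul_mul_comm, ← mul_inv, Real.mul_self_sqrt (by positivity), ← Real.exp_add]
    congr 2
    ring
  have hfin : ∀ p : ℝ × ℝ, gaussianPDF 0 1 p.1 * gaussianPDF 0 1 p.2 < ⊤ := fun p =>
    ENNReal.mul_lt_top ENNReal.ofReal_lt_top ENNReal.ofReal_lt_top
  rw [gaussianReal_of_var_ne_zero _ one_ne_zero, prod_withDensity (measurable_gaussianPDF _ _)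
    (measurable_gaussianPDF _ _), integral_withDensity_eq_integral_toReal_smul (by fun_prop)
    (.of_forall hfin)]
  simp_rw [hd, smul_eq_mul]
  rw [← Measure.volume_eq_prod, ← integral_comp_polarCoord_symm, polarCoord_target,
    Measure.volume_eq_prod, ← Measure.prod_restrict]
  -- The radial exponent `k + 1` is the degree of `F` plus one from the polar Jacobian.
  have hr := integral_pow_mul_exp_neg_sq k 1
  have hg : ∫ t in Set.Ioi (0 : ℝ), t ^ ((k : ℝ) / 2) * Real.exp (-t) =
      Real.Gamma ((k : ℝ) / 2 + 1) := by
    rw [Real.Gamma_eq_integral (by positivity), add_sub_cancel_right]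
    simp_rw [mul_comm]
  simp only [Pi.one_apply, one_mul] at hr
  rw [hg] at hr
  rw [← hr, div_mul_eq_mul_div, mul_div_assoc, ← integral_div, ← integral_prod_mul]
  rw [Measure.prod_restrict]
  refine setIntegral_congr_fun (measurableSet_Ioi.prod measurableSet_Ioo) fun p hp => ?_
  have hp1 : 0 < p.1 := hp.1
  have hF' : F (p.1 * Real.cos p.2, p.1 * Real.sin p.2) =
      p.1 ^ k * F (Real.cos p.2, Real.sin p.2) := by
    rw [← hF _ _ hp1]; simp
  have hn : (p.1 * Real.cos p.2) ^ 2 + (p.1 * Real.sin p.2) ^ 2 = p.1 ^ 2 := by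
    rw [mul_pow, mul_pow, ← mul_add, Real.cos_sq_add_sin_sq, mul_one]
  simp only [polarCoord_symm_apply, smul_eq_mul, hF', hn]
  ring

/-- The points of the plane that have a positive inner product with both `(1, 0)` and
`(cos θ, sin θ)`. -/
def sector (θ : ℝ) : Set (ℝ × ℝ) := {p | 0 < p.1 ∧ 0 < Real.cos θ * p.1 + Real.sin θ * p.2}

theorem measurableSet_sector (θ : ℝ) : MeasurableSet (sector θ) :=
  measurableSet_setOfPred.2 ((measurableSet_setOfPred.1 (measurableSet_lt (by fun_prop)
    (by fun_prop))).and (measurableSet_setOfPred.1 (measurableSet_lt (by fun_prop) (by fun_prop))))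

theorem smul_mem_sector {θ r : ℝ} (hr : 0 < r) (p : ℝ × ℝ) : r • p ∈ sector θ ↔ p ∈ sector θ := by
  have : Real.cos θ * (r * p.1) + Real.sin θ * (r * p.2) =
      r * (Real.cos θ * p.1 + Real.sin θ * p.2) := by ring
  simp [sector, this, hr]

/-- The conditions read `cos φ > 0` and `cos (φ - θ) > 0`. The first means `|φ| < π/2`; then `φ - θ`
lies in `(-3π/2, π/2)`, where the cosine is positive exactly above `-π/2`. -/
theorem cos_sin_mem_sector_iff {θ φ : ℝ} (h0 : 0 ≤ θ) (hπ : θ ≤ Real.pi)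
    (hφ : φ ∈ Set.Ioo (-Real.pi) Real.pi) :
    (Real.cos φ, Real.sin φ) ∈ sector θ ↔ φ ∈ Set.Ioo (θ - Real.pi / 2) (Real.pi / 2) := by
  have hπ0 := Real.pi_pos
  have hc : Real.cos θ * Real.cos φ + Real.sin θ * Real.sin φ = Real.cos (φ - θ) := by
    rw [Real.cos_sub]; ring
  simp only [sector, Set.mem_ofPred_eq, hc, Set.mem_Ioo]
  constructor
  · rintro ⟨h1, h2⟩
    have h3 : φ < Real.pi / 2 := by
      by_contra! h
      exact absurd (Real.cos_nonpos_of_pi_div_two_le_of_le h (by linarith [hφ.2])) (by linarith)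
    have h4 : -(Real.pi / 2) < φ := by
      by_contra! h
      have := Real.cos_nonpos_of_pi_div_two_le_of_le (x := -φ) (by linarith) (by linarith [hφ.1])
      rw [Real.cos_neg] at this
      linarith
    refine ⟨?_, h3⟩
    by_contra! h
    have := Real.cos_nonpos_of_pi_div_two_le_of_le (x := -(φ - θ)) (by linarith) (by linarith)
    rw [Real.cos_neg] at this
    linarith
  · rintro ⟨h1, h2⟩
    exact ⟨Real.cos_pos_of_mem_Ioo ⟨by linarith, h2⟩,
      Real.cos_pos_of_mem_Ioo ⟨by linarith, by linarith⟩⟩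

theorem integral_sector_homogeneous {k : ℕ} {F : ℝ × ℝ → ℝ}
    (hF : ∀ (r : ℝ) p, 0 < r → F (r • p) = r ^ k * F p) {θ : ℝ} (h0 : 0 ≤ θ)
    (hπ : θ ≤ Real.pi) :
    ∫ p in sector θ, F p ∂((gaussianReal 0 1).prod (gaussianReal 0 1)) =
      2 ^ ((k : ℝ) / 2) * Real.Gamma ((k : ℝ) / 2 + 1) / (2 * Real.pi) *
        ∫ φ in (θ - Real.pi / 2)..(Real.pi / 2), F (Real.cos φ, Real.sin φ) := by
  have hπ0 := Real.pi_pos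
  rw [← integral_indicator (measurableSet_sector θ), integral_gaussianReal_prod_homogeneous (k := k),
    intervalIntegral.integral_of_le (by linarith), integral_Ioc_eq_integral_Ioo]
  · congr 1
    have hsub : Set.Ioo (θ - Real.pi / 2) (Real.pi / 2) =
        Set.Ioo (-Real.pi) Real.pi ∩ Set.Ioo (θ - Real.pi / 2) (Real.pi / 2) :=
      (Set.inter_eq_right.2 (Set.Ioo_subset_Ioo (by linarith) (by linarith))).symm
    rw [hsub, ← setIntegral_indicator measurableSet_Ioo]
    refine setIntegral_congr_fun measurableSet_Ioo fun φ hφ => ?_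
    have := cos_sin_mem_sector_iff h0 hπ hφ
    by_cases h : φ ∈ Set.Ioo (θ - Real.pi / 2) (Real.pi / 2)
    · simp only [Set.indicator_of_mem h, Set.indicator_of_mem (this.2 h)]
    · simp only [Set.indicator_of_notMem h, Set.indicator_of_notMem (fun h' => h (this.1 h'))]
  · intro r p hr
    by_cases h : p ∈ sector θ
    · rw [Set.indicator_of_mem h, Set.indicator_of_mem ((smul_mem_sector hr p).2 h), hF r p hr]
    · rw [Set.indicator_of_notMem h, Set.indicator_of_notMem (fun h' =>
        h ((smul_mem_sector hr p).1 h')), mul_zero]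

theorem measureReal_sector {θ : ℝ} (h0 : 0 ≤ θ) (hπ : θ ≤ Real.pi) :
    ((gaussianReal 0 1).prod (gaussianReal 0 1)).real (sector θ) =
      (Real.pi - θ) / (2 * Real.pi) := by
  have h := integral_sector_homogeneous (k := 0) (F := fun _ => 1) (by simp) h0 hπ
  simp only [setIntegral_const, smul_eq_mul, mul_one] at h
  rw [h]
  simp
  ring

/-- The last bracket is the quadratic form at `(a, b)` of the reflection exchanging `(1, 0)` and
`(cos θ, sin θ)`, which is how the swap matrix arises. -/
theorem integral_sector_sq {θ : ℝ} (h0 : 0 ≤ θ) (hπ : θ ≤ Real.pi) (a b : ℝ) :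
    ∫ p in sector θ, (a * p.1 + b * p.2) ^ 2 ∂((gaussianReal 0 1).prod (gaussianReal 0 1)) =
      (Real.pi - θ) / (2 * Real.pi) * (a ^ 2 + b ^ 2) + Real.sin θ / (2 * Real.pi) *
        ((a ^ 2 - b ^ 2) * Real.cos θ + 2 * a * b * Real.sin θ) := by
  rw [integral_sector_homogeneous (k := 2) (fun r p _ => by simp; ring) h0 hπ]
  have hG : (2 : ℝ) ^ (((2 : ℕ) : ℝ) / 2) * Real.Gamma (((2 : ℕ) : ℝ) / 2 + 1) = 2 := by
    norm_num [Real.Gamma_two]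
  have hderiv : ∀ φ ∈ Set.uIcc (θ - Real.pi / 2) (Real.pi / 2),
      HasDerivAt (fun φ => (a ^ 2 + b ^ 2) / 2 * φ + (a ^ 2 - b ^ 2) / 2 *
        (Real.sin φ * Real.cos φ) + a * b * Real.sin φ ^ 2)
        ((a * Real.cos φ + b * Real.sin φ) ^ 2) φ := by
    intro φ _
    have h1 := ((hasDerivAt_id φ).const_mul ((a ^ 2 + b ^ 2) / 2)).add
      (((Real.hasDerivAt_sin φ).mul (Real.hasDerivAt_cos φ)).const_mul ((a ^ 2 - b ^ 2) / 2))
    have h2 := h1.add (((Real.hasDerivAt_sin φ).pow 2).const_mul (a * b))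
    refine (h2.congr_deriv ?_)
    have := Real.sin_sq_add_cos_sq φ
    simp
    linear_combination (-(a ^ 2 + b ^ 2) / 2) * this
  rw [hG, intervalIntegral.integral_eq_sub_of_hasDerivAt hderiv
    (Continuous.intervalIntegrable (by fun_prop) _ _)]
  have hs : Real.sin (θ - Real.pi / 2) = -Real.cos θ := Real.sin_sub_pi_div_two θ
  have hc : Real.cos (θ - Real.pi / 2) = Real.sin θ := Real.cos_sub_pi_div_two θ
  rw [hs, hc, Real.sin_pi_div_two, Real.cos_pi_div_two]
  have hπ0 := Real.pi_pos
  have := Real.sin_sq_add_cos_sq θ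
  field_simp
  linear_combination (-4 * a * b : ℝ) * this

/-- The third coordinate is independent of the sector and centered, so the cross term vanishes and
`c²` is multiplied by the measure of the sector. -/
theorem integral_gaussian_sector_sq {n : ℕ} {e : Fin 3 → EuclideanSpace ℝ (Fin n)}
    (he : Orthonormal ℝ e) {θ : ℝ} (h0 : 0 ≤ θ) (hπ : θ ≤ Real.pi) (a b c : ℝ) :
    ∫ g in {g | (inner ℝ (e 0) g, inner ℝ (e 1) g) ∈ sector θ},
        (a * inner ℝ (e 0) g + b * inner ℝ (e 1) g + c * inner ℝ (e 2) g) ^ 2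
        ∂(stdGaussian (EuclideanSpace ℝ (Fin n))) =
      (Real.pi - θ) / (2 * Real.pi) * (a ^ 2 + b ^ 2 + c ^ 2) + Real.sin θ / (2 * Real.pi) *
        ((a ^ 2 - b ^ 2) * Real.cos θ + 2 * a * b * Real.sin θ) := by
  set μ := stdGaussian (EuclideanSpace ℝ (Fin n))
  set G : Fin 3 → EuclideanSpace ℝ (Fin n) → ℝ := fun i g => inner ℝ (e i) g with hG
  have hmeas : ∀ i, Measurable (G i) := fun i => by simp only [hG]; fun_prop
  have hind : iIndepFun G μ := iIndepFun_inner_of_orthonormal he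
  have hlaw : ∀ i, HasLaw (G i) (gaussianReal 0 1) μ := fun i => hasLaw_inner_stdGaussian (he.1 i)
  have hX : Measurable fun g => (G 0 g, G 1 g) := (hmeas 0).prodMk (hmeas 1)
  have hind2 : IndepFun (fun g => (G 0 g, G 1 g)) (G 2) μ :=
    hind.indepFun_prodMk hmeas 0 1 2 (by decide) (by decide)
  have hlaw2 : μ.map (fun g => (G 0 g, G 1 g)) =
      (gaussianReal 0 1).prod (gaussianReal 0 1) := by
    rw [(indepFun_iff_map_prod_eq_prod_map_map (hmeas 0).aemeasurable (hmeas 1).aemeasurable).1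
      (hind.indepFun (by decide)), (hlaw 0).map_eq, (hlaw 1).map_eq]
  have hS := measurableSet_sector θ
  have hS' : MeasurableSet {g | (G 0 g, G 1 g) ∈ sector θ} := hX hS
  have hLp : ∀ i, MemLp (G i) 2 μ := fun i => by
    have := IsGaussian.memLp_two_id (μ := gaussianReal 0 1)
    rw [← (hlaw i).map_eq] at this
    exact this.comp_of_map (hmeas i).aemeasurable
  have hAL : MemLp (fun g => a * G 0 g + b * G 1 g) 2 μ :=
    ((hLp 0).const_mul a).add ((hLp 1).const_mul b)
  have hsplit : ∀ φ : ℝ × ℝ → ℝ, Measurable φ → ∀ ψ : ℝ → ℝ, Measurable ψ →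
      ∫ g in {g | (G 0 g, G 1 g) ∈ sector θ}, φ (G 0 g, G 1 g) * ψ (G 2 g) ∂μ =
        (∫ p in sector θ, φ p ∂((gaussianReal 0 1).prod (gaussianReal 0 1))) *
          ∫ t, ψ t ∂(gaussianReal 0 1) := by
    intro φ hφ ψ hψ
    have h := hind2.integral_fun_comp_mul_comp hX.aemeasurable (hmeas 2).aemeasurable
      (f := (sector θ).indicator φ) (g := ψ) (hφ.indicator hS).aestronglyMeasurable
      hψ.aestronglyMeasurable
    rw [← integral_indicator hS, ← hlaw2, ← (hlaw 2).map_eq,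
      integral_map hX.aemeasurable (hφ.indicator hS).aestronglyMeasurable,
      integral_map (hmeas 2).aemeasurable hψ.aestronglyMeasurable, ← h, ← integral_indicator hS']
    refine integral_congr_ae (.of_forall fun g => ?_)
    by_cases hg : (G 0 g, G 1 g) ∈ sector θ
    · simp [Set.indicator_of_mem hg,
        Set.indicator_of_mem (show g ∈ {g | (G 0 g, G 1 g) ∈ sector θ} from hg)]
    · simp [Set.indicator_of_notMem hg,
        Set.indicator_of_notMem (show g ∉ {g | (G 0 g, G 1 g) ∈ sector θ} from hg)]
  have hsq : ∫ t, t ^ 2 ∂(gaussianReal 0 1) = 1 := by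
    have := variance_id_gaussianReal (μ := 0) (v := 1)
    rw [variance_eq_integral (by fun_prop)] at this
    simpa [integral_id_gaussianReal] using this
  have i1 := hsplit (fun p => (a * p.1 + b * p.2) ^ 2) (by fun_prop) (fun _ => 1) (by fun_prop)
  have i2 := hsplit (fun p => a * p.1 + b * p.2) (by fun_prop) (fun t => t) (by fun_prop)
  have i3 := hsplit (fun _ => 1) (by fun_prop) (fun t => t ^ 2) (by fun_prop)
  simp only [integral_const, measureReal_restrict_apply_univ, probReal_univ, smul_eq_mul, mul_one, one_mul,
    integral_id_gaussianReal, mul_zero, hsq, measureReal_sector h0 hπ,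
    integral_sector_sq h0 hπ] at i1 i2 i3
  have hexp : ∀ g, (a * G 0 g + b * G 1 g + c * G 2 g) ^ 2 = (a * G 0 g + b * G 1 g) ^ 2 +
      (2 * c * ((a * G 0 g + b * G 1 g) * G 2 g) + c ^ 2 * G 2 g ^ 2) := fun g => by ring
  have j1 : Integrable (fun g => (a * G 0 g + b * G 1 g) ^ 2) μ := hAL.integrable_sq
  have j2 : Integrable (fun g => (a * G 0 g + b * G 1 g) * G 2 g) μ := hAL.integrable_mul (hLp 2)
  have j3 : Integrable (fun g => G 2 g ^ 2) μ := (hLp 2).integrable_sq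
  change ∫ g in {g | (G 0 g, G 1 g) ∈ sector θ}, (a * G 0 g + b * G 1 g + c * G 2 g) ^ 2 ∂μ = _
  simp_rw [hexp]
  have j4 : Integrable (fun g => 2 * c * ((a * G 0 g + b * G 1 g) * G 2 g) + c ^ 2 * G 2 g ^ 2) μ :=
    (j2.const_mul _).add (j3.const_mul _)
  rw [integral_add j1.integrableOn j4.integrableOn,
    integral_add (j2.const_mul _).integrableOn (j3.const_mul _).integrableOn,
    integral_const_mul, integral_const_mul, i1, i2, i3]
  ring

/-! ### The mean of the quadratic form -/

/-- In a space of dimension larger than that of `K`, every vector is the sum of a vector of `K`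
and a nonnegative multiple of a unit vector that is orthogonal to `K`. -/
theorem exists_unit_orthogonal {n : ℕ} (K : Submodule ℝ (EuclideanSpace ℝ (Fin n)))
    (hK : Module.finrank ℝ K < n) (v : EuclideanSpace ℝ (Fin n)) :
    ∃ e ∈ Kᗮ, ‖e‖ = 1 ∧ ∃ c : ℝ, 0 ≤ c ∧ v - c • e ∈ K := by
  obtain ⟨y, hy, z, hz, hv⟩ := K.exists_add_mem_mem_orthogonal v
  by_cases hz0 : z = 0
  · have hne : Kᗮ ≠ ⊥ := by
      intro h
      have := K.finrank_add_finrank_orthogonal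
      rw [h, finrank_bot, finrank_euclideanSpace_fin] at this
      omega
    obtain ⟨w, hw, hw0⟩ := Submodule.exists_mem_ne_zero_of_ne_bot hne
    refine ⟨‖w‖⁻¹ • w, Submodule.smul_mem _ _ hw, by simp [norm_smul, hw0], 0, le_rfl, ?_⟩
    simpa [hv, hz0] using hy
  · refine ⟨‖z‖⁻¹ • z, Submodule.smul_mem _ _ hz, by simp [norm_smul, hz0], ‖z‖,
      norm_nonneg _, ?_⟩
    rw [smul_inv_smul₀ (norm_ne_zero_iff.2 hz0), hv, add_sub_cancel_right]
    exact hy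

open InnerProductGeometry in
/-- Unit vectors `x`, `y` and a vector `u` in coordinates adapted to the plane of `x` and `y`. -/
theorem exists_adapted_orthonormal {n : ℕ} (hn : 3 ≤ n) {x y : EuclideanSpace ℝ (Fin n)}
    (hx : ‖x‖ = 1) (hy : ‖y‖ = 1) (u : EuclideanSpace ℝ (Fin n)) :
    ∃ e : Fin 3 → EuclideanSpace ℝ (Fin n), Orthonormal ℝ e ∧ x = e 0 ∧
      y = Real.cos (angle x y) • e 0 + Real.sin (angle x y) • e 1 ∧
      ∃ a b c : ℝ, u = a • e 0 + b • e 1 + c • e 2 := by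
  obtain ⟨e1, he1, hn1, b, hb, hyb⟩ := exists_unit_orthogonal (Submodule.span ℝ {x})
    ((finrank_span_le_card ({x} : Set (EuclideanSpace ℝ (Fin n)))).trans_lt (by simp; omega)) y
  obtain ⟨e2, he2, hn2, c, hc, huc⟩ := exists_unit_orthogonal (Submodule.span ℝ {x, e1})
    (by
      classical
      have h := finrank_span_finset_le_card (R := ℝ) ({x, e1} : Finset (EuclideanSpace ℝ (Fin n)))
      rw [Finset.coe_pair] at h
      exact (h.trans Finset.card_le_two).trans_lt (by omega)) u
  obtain ⟨a, ha⟩ := Submodule.mem_span_singleton.1 hyb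
  obtain ⟨a', b', hab⟩ := Submodule.mem_span_pair.1 huc
  have h01 : inner ℝ x e1 = 0 := he1 x (Submodule.mem_span_singleton_self x)
  have h02 : inner ℝ x e2 = 0 := he2 x (Submodule.subset_span (by simp))
  have h12 : inner ℝ e1 e2 = 0 := he2 e1 (Submodule.subset_span (by simp))
  have hyab : y = a • x + b • e1 := by rw [ha]; abel
  have hcos : Real.cos (angle x y) = a := by
    rw [cos_angle, hx, hy, hyab, inner_add_right, real_inner_smul_right, real_inner_smul_right,
      h01, real_inner_self_eq_norm_sq, hx]
    simp
  -- The normalization `0 ≤ b` selects the sign: `b² = sin²` and both are nonnegative.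
  have hsin : Real.sin (angle x y) = b := by
    have h1 : ‖y‖ ^ 2 = a ^ 2 + b ^ 2 := by
      rw [hyab, norm_add_sq_real, real_inner_smul_left, real_inner_smul_right, h01]
      simp [norm_smul, hx, hn1]
    have h2 := Real.sin_sq_add_cos_sq (angle x y)
    rw [hcos] at h2
    rw [hy] at h1
    exact (pow_left_inj₀ (sin_angle_nonneg x y) hb two_ne_zero).1 (by linarith)
  refine ⟨![x, e1, e2], ?_, rfl, ?_, a', b', c, ?_⟩
  · rw [orthonormal_iff_ite]
    intro i j
    fin_cases i <;> fin_cases j <;>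
      simp [hx, hn1, hn2, h01, h02, h12, real_inner_comm x e1,
        real_inner_comm x e2, real_inner_comm e1 e2]
  · rw [hcos, hsin]
    exact hyab
  · rw [← sub_eq_iff_eq_add]
    exact hab.symm

theorem inner_toEuclideanCLM_lineProj {n : ℕ} (v u : EuclideanSpace ℝ (Fin n)) :
    inner ℝ u (Matrix.toEuclideanCLM (n := Fin n) (𝕜 := ℝ) (lineProj v) u) =
      (‖v‖ ^ 2)⁻¹ * inner ℝ v u ^ 2 := by
  have h : Matrix.toEuclideanCLM (n := Fin n) (𝕜 := ℝ) (lineProj v) u =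
      ((‖v‖ ^ 2)⁻¹ * inner ℝ v u) • v := by
    ext i
    rw [Matrix.ofLp_toEuclideanCLM, lineProj_mulVec]
    rfl
  rw [h, real_inner_smul_right, real_inner_comm v u]
  ring

open InnerProductGeometry in
theorem inner_toEuclideanCLM_QMatrix {n : ℕ} {x y : EuclideanSpace ℝ (Fin n)}
    (hx : ‖x‖ = 1) (hy : ‖y‖ = 1) (u : EuclideanSpace ℝ (Fin n)) :
    inner ℝ u (Matrix.toEuclideanCLM (n := Fin n) (𝕜 := ℝ) (QMatrix x y) u) =
      (Real.pi - angle x y) / (2 * Real.pi) * ‖u‖ ^ 2 + Real.sin (angle x y) / (2 * Real.pi) *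
        ((‖x + y‖ ^ 2)⁻¹ * inner ℝ (x + y) u ^ 2 - (‖x - y‖ ^ 2)⁻¹ * inner ℝ (x - y) u ^ 2) := by
  have hx' : unitVec x = x := by simp [unitVec, hx]
  have hy' : unitVec y = y := by simp [unitVec, hy]
  simp only [QMatrix, swapMatrix, hx', hy', map_add, map_sub, map_smul, map_one,
    add_apply, sub_apply, smul_apply,
    one_apply_eq_self, inner_add_right, inner_sub_right, real_inner_smul_right,
    inner_toEuclideanCLM_lineProj, real_inner_self_eq_norm_sq]

open InnerProductGeometry in
theorem integral_cone_sq {n : ℕ} (hn : 3 ≤ n) {x y : EuclideanSpace ℝ (Fin n)}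
    (hx : ‖x‖ = 1) (hy : ‖y‖ = 1) (u : EuclideanSpace ℝ (Fin n)) :
    ∫ g in {g | 0 < inner ℝ x g ∧ 0 < inner ℝ y g}, inner ℝ u g ^ 2
        ∂(stdGaussian (EuclideanSpace ℝ (Fin n))) =
      inner ℝ u (Matrix.toEuclideanCLM (n := Fin n) (𝕜 := ℝ) (QMatrix x y) u) := by
  obtain ⟨e, he, hxe, hye, a, b, c, hu⟩ := exists_adapted_orthonormal hn hx hy u
  have hs := Real.sin_sq_add_cos_sq (angle x y)
  rw [inner_toEuclideanCLM_QMatrix hx hy]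
  set θ := angle x y with hθ
  have h := integral_gaussian_sector_sq he (angle_nonneg x y) (angle_le_pi x y) a b c
  have e0 := he.1 0
  have e1 := he.1 1
  have e2 := he.1 2
  have e01 : inner ℝ (e 0) (e 1) = 0 := he.2 (by decide)
  have e02 : inner ℝ (e 0) (e 2) = 0 := he.2 (by decide)
  have e12 : inner ℝ (e 1) (e 2) = 0 := he.2 (by decide)
  have e10 : inner ℝ (e 1) (e 0) = 0 := he.2 (by decide)
  have hxu : inner ℝ x u = a := by
    rw [hu, hxe]
    simp [inner_add_right, real_inner_smul_right, e0, e01, e02]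
  have hyu : inner ℝ y u = Real.cos θ * a + Real.sin θ * b := by
    rw [hu, hye]
    simp [inner_add_right, inner_add_left, real_inner_smul_left, real_inner_smul_right,
      e0, e1, e01, e02, e12, e10, mul_comm]
  have hxy : inner ℝ x y = Real.cos θ := by rw [hθ, cos_angle, hx, hy]; simp
  have hun : ‖u‖ ^ 2 = a ^ 2 + b ^ 2 + c ^ 2 := by
    rw [hu, norm_add_sq_real, norm_add_sq_real]
    simp [inner_add_left, real_inner_smul_left, real_inner_smul_right, norm_smul, e0, e1, e2, e01,
      e02, e12]
  calc _ = _ := ?_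
    _ = _ := h
    _ = _ := ?_
  · have hset : {g | 0 < inner ℝ x g ∧ 0 < inner ℝ y g} =
        {g | (inner ℝ (e 0) g, inner ℝ (e 1) g) ∈ sector θ} := by
      ext g
      simp only [Set.mem_ofPred_eq, sector]
      rw [hye, hxe, inner_add_left, real_inner_smul_left, real_inner_smul_left]
    rw [hset]
    refine integral_congr_ae (.of_forall fun g => ?_)
    simp only [hu, inner_add_left, real_inner_smul_left]
  · rw [inner_add_left, inner_sub_left, hxu, hyu, norm_add_sq_real, norm_sub_sq_real, hx, hy, hxy,
      hun]
    congr 1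
    -- If `sin θ = 0`, then `x = ±y` and one of the two projections degenerates, but its coefficient
    -- vanishes. Otherwise `‖x ± y‖² = 2 (1 ± cos θ)` are both positive.
    by_cases h0 : Real.sin θ = 0
    · simp [← hθ, h0]
    · have hp : 0 < 1 + Real.cos θ ∧ 0 < 1 - Real.cos θ := by
        have h1 : 0 < (1 + Real.cos θ) * (1 - Real.cos θ) := by
          have : 0 < Real.sin θ ^ 2 := by positivity
          nlinarith
        have h2 := Real.cos_le_one θ
        have h3 := Real.neg_one_le_cos θ
        constructor <;> nlinarith
      congr 1
      have d1 : (1 : ℝ) ^ 2 + 2 * Real.cos θ + 1 ^ 2 = 2 * (1 + Real.cos θ) := by ring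
      have d2 : (1 : ℝ) ^ 2 - 2 * Real.cos θ + 1 ^ 2 = 2 * (1 - Real.cos θ) := by ring
      rw [d1, d2]
      have := hp.1.ne'
      have := hp.2.ne'
      field_simp
      have hs2 : Real.sin θ ^ 2 = 1 - Real.cos θ ^ 2 := by linarith
      ring_nf
      simp only [hs2]
      ring

/-- The quadratic form of the truncated vector, cut off to the intersection of two half-spaces. -/
noncomputable def coneSq {n : ℕ} (R τ : ℝ) (x y u g : EuclideanSpace ℝ (Fin n)) : ℝ :=
  Set.indicator {g | τ < inner ℝ x g ∧ τ < inner ℝ y g ∧ ‖g‖ ≤ R} (fun g => inner ℝ u g ^ 2) g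

theorem measurableSet_cone {n : ℕ} (R τ : ℝ) (x y : EuclideanSpace ℝ (Fin n)) :
    MeasurableSet {g | τ < inner ℝ x g ∧ τ < inner ℝ y g ∧ ‖g‖ ≤ R} :=
  (measurableSet_lt measurable_const (by fun_prop : Measurable fun g => inner ℝ x g)).inter
    ((measurableSet_lt measurable_const (by fun_prop : Measurable fun g => inner ℝ y g)).inter
      (measurableSet_le measurable_norm measurable_const))

/-- The cone is invariant under positive scaling, so truncation only contributes the factor
`truncAlpha n`. The bound `3 ≤ n` leaves room for a direction orthogonal to the plane of `x` and
`y`. -/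
theorem integral_coneSq {n : ℕ} (hn : 3 ≤ n) {x y : EuclideanSpace ℝ (Fin n)}
    (hx : ‖x‖ = 1) (hy : ‖y‖ = 1) (u : EuclideanSpace ℝ (Fin n)) :
    ∫ g, coneSq (3 * Real.sqrt n) 0 x y u g ∂(stdGaussian (EuclideanSpace ℝ (Fin n))) =
      truncAlpha n *
        inner ℝ u (Matrix.toEuclideanCLM (n := Fin n) (𝕜 := ℝ) (QMatrix x y) u) := by
  have : NeZero n := ⟨by omega⟩
  have hm : MeasurableSet {g | 0 < inner ℝ x g ∧ 0 < inner ℝ y g} :=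
    (measurableSet_lt measurable_const (by fun_prop : Measurable fun g => inner ℝ x g)).inter
      (measurableSet_lt measurable_const (by fun_prop : Measurable fun g => inner ℝ y g))
  rw [← integral_cone_sq hn hx hy u, ← integral_indicator hm, ← integral_homogeneous_truncated,
    ← integral_indicator (measurableSet_le measurable_norm measurable_const)]
  · refine integral_congr_ae (.of_forall fun g => ?_)
    simp only [coneSq, Set.indicator_apply, Set.mem_ofPred_eq]
    split_ifs <;> tauto
  · intro r g hr
    simp only [Set.indicator_apply, Set.mem_ofPred_eq, real_inner_smul_right,
      mul_pos_iff_of_pos_left hr]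
    split_ifs <;> ring

/-! ### A Bernstein inequality for variables dominated by squared Gaussians -/

theorem exp_le_one_add_add_sq_mul_exp_abs (t : ℝ) :
    Real.exp t ≤ 1 + t + t ^ 2 * Real.exp |t| := by
  have h := Complex.norm_exp_sub_sum_le_norm_mul_exp t 2
  simp only [Finset.sum_range_succ, Finset.sum_range_zero, pow_zero, Nat.factorial_zero,
    Nat.cast_one, div_one, zero_add, pow_one, Nat.factorial_one] at h
  rw [← Complex.ofReal_exp, ← Complex.ofReal_one, ← Complex.ofReal_add, ← Complex.ofReal_sub,
    Complex.norm_real, Complex.norm_real, Real.norm_eq_abs, Real.norm_eq_abs, sq_abs] at h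
  linarith [(abs_le.1 h).2]

theorem integrable_exp_sq_div_four_gaussianReal :
    Integrable (fun t : ℝ => Real.exp (t ^ 2 / 4)) (gaussianReal 0 1) := by
  rw [gaussianReal_of_var_ne_zero _ one_ne_zero,
    integrable_withDensity_iff_integrable_smul' (measurable_gaussianPDF _ _)
      (.of_forall fun _ => ENNReal.ofReal_lt_top)]
  refine ((integrable_exp_neg_mul_sq (b := 1 / 4) (by norm_num)).const_mul
    (Real.sqrt (2 * Real.pi))⁻¹).congr (.of_forall fun t => ?_)
  simp only [toReal_gaussianPDF, gaussianPDFReal_def, NNReal.coe_one, mul_one, sub_zero,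
    smul_eq_mul]
  rw [mul_assoc, ← Real.exp_add]
  congr 2
  ring

/-- From `s/16 ≤ exp (s/16)` the square `s²` is at most `256 exp (s/8)`, with `s = t² + 1`. The
product is then bounded by a multiple of `exp (t²/4)`, which the Gaussian density still dominates.
-/
theorem integrable_bernstein_gaussianReal :
    Integrable (fun t : ℝ => (t ^ 2 + 1) ^ 2 * Real.exp ((t ^ 2 + 1) / 8)) (gaussianReal 0 1) := by
  refine (integrable_exp_sq_div_four_gaussianReal.const_mul (256 * Real.exp (1 / 4))).mono'
    (by fun_prop) (.of_forall fun t => ?_)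
  rw [Real.norm_of_nonneg (by positivity), mul_assoc, ← Real.exp_add]
  have h1 : (t ^ 2 + 1) / 16 ≤ Real.exp ((t ^ 2 + 1) / 16) := by
    linarith [Real.add_one_le_exp ((t ^ 2 + 1) / 16)]
  have h2 := pow_le_pow_left₀ (by positivity) h1 2
  rw [← Real.exp_nat_mul] at h2
  have h3 : (t ^ 2 + 1) ^ 2 ≤ 256 * Real.exp ((t ^ 2 + 1) / 8) := by
    convert (by linarith : (t ^ 2 + 1) ^ 2 ≤ 256 * Real.exp (((2 : ℕ) : ℝ) * ((t ^ 2 + 1) / 16)))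
      using 3
    push_cast
    ring
  calc _ ≤ 256 * Real.exp ((t ^ 2 + 1) / 8) * Real.exp ((t ^ 2 + 1) / 8) := by gcongr
    _ = _ := by rw [mul_assoc, ← Real.exp_add]; congr 2; ring

/-- The constant in the Bernstein inequality for variables dominated by a squared Gaussian. -/
noncomputable def bernsteinConst : ℝ :=
  4 + ∫ t, (t ^ 2 + 1) ^ 2 * Real.exp ((t ^ 2 + 1) / 8) ∂(gaussianReal 0 1)

theorem four_le_bernsteinConst : 4 ≤ bernsteinConst :=
  le_add_of_nonneg_right (integral_nonneg fun t => by positivity)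

theorem integral_sq_of_hasLaw {Ω : Type*} [MeasurableSpace Ω] {P : Measure Ω}
    {Y : Ω → ℝ} (hY : HasLaw Y (gaussianReal 0 1) P) :
    Integrable (fun ω => Y ω ^ 2) P ∧ ∫ ω, Y ω ^ 2 ∂P = 1 := by
  have h : Integrable (fun t : ℝ => t ^ 2) (gaussianReal 0 1) :=
    (IsGaussian.memLp_two_id (μ := gaussianReal 0 1)).integrable_sq
  have hsq : ∫ t, t ^ 2 ∂(gaussianReal 0 1) = 1 := by
    have := variance_id_gaussianReal (μ := 0) (v := 1)
    rw [variance_eq_integral (by fun_prop)] at this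
    simpa [integral_id_gaussianReal] using this
  refine ⟨?_, (hY.integral_comp h.1).trans hsq⟩
  rw [← hY.map_eq] at h
  exact h.comp_aemeasurable hY.aemeasurable

/-- The moment generating function of a centered variable dominated by `Y ^ 2 + 1`. -/
theorem mgf_le_of_abs_le {Ω : Type*} [MeasurableSpace Ω] {P : Measure Ω}
    [IsProbabilityMeasure P] {D Y : Ω → ℝ} (hD : AEMeasurable D P)
    (hY : HasLaw Y (gaussianReal 0 1) P) (hDY : ∀ ω, |D ω| ≤ Y ω ^ 2 + 1)
    (hmean : ∫ ω, D ω ∂P = 0) {t : ℝ} (ht : |t| ≤ 1 / 8) :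
    Integrable (fun ω => Real.exp (t * D ω)) P ∧ mgf D P t ≤ Real.exp (bernsteinConst * t ^ 2) := by
  have hK : Integrable (fun ω => (Y ω ^ 2 + 1) ^ 2 * Real.exp ((Y ω ^ 2 + 1) / 8)) P := by
    have h := integrable_bernstein_gaussianReal
    rw [← hY.map_eq] at h
    exact h.comp_aemeasurable hY.aemeasurable
  have hKi : ∫ ω, (Y ω ^ 2 + 1) ^ 2 * Real.exp ((Y ω ^ 2 + 1) / 8) ∂P ≤ bernsteinConst := by
    have := hY.integral_comp integrable_bernstein_gaussianReal.1
    have h2 : bernsteinConst = 4 + _ := rfl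
    rw [← this] at h2
    simp only [Function.comp_def] at h2
    linarith
  have hDi : Integrable D P := by
    refine ((integral_sq_of_hasLaw hY).1.add (integrable_const 1)).mono' hD.aestronglyMeasurable
      (.of_forall fun ω => hDY ω)
  have hbound : ∀ ω, Real.exp (t * D ω) ≤
      1 + t * D ω + t ^ 2 * ((Y ω ^ 2 + 1) ^ 2 * Real.exp ((Y ω ^ 2 + 1) / 8)) := by
    intro ω
    refine (exp_le_one_add_add_sq_mul_exp_abs _).trans ?_
    have h1 : D ω ^ 2 ≤ (Y ω ^ 2 + 1) ^ 2 := sq_le_sq' (by linarith [abs_le.1 (hDY ω)])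
      (abs_le.1 (hDY ω)).2
    have h2 : |t * D ω| ≤ (Y ω ^ 2 + 1) / 8 := by
      rw [abs_mul]
      calc _ ≤ 1 / 8 * (Y ω ^ 2 + 1) := mul_le_mul ht (hDY ω) (abs_nonneg _) (by norm_num)
        _ = _ := by ring
    rw [mul_pow, mul_assoc]
    gcongr
  have hmaj : Integrable (fun ω => 1 + t * D ω +
      t ^ 2 * ((Y ω ^ 2 + 1) ^ 2 * Real.exp ((Y ω ^ 2 + 1) / 8))) P :=
    ((integrable_const 1).add (hDi.const_mul t)).add (hK.const_mul _)
  have hexp : Integrable (fun ω => Real.exp (t * D ω)) P :=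
    hmaj.mono' (hD.const_mul t).exp.aestronglyMeasurable
      (.of_forall fun ω => by rw [Real.norm_of_nonneg (Real.exp_pos _).le]; exact hbound ω)
  refine ⟨hexp, (integral_mono hexp hmaj hbound).trans ?_⟩
  have hadd : Integrable (fun ω => 1 + t * D ω) P := (integrable_const 1).add (hDi.const_mul t)
  rw [integral_add hadd (hK.const_mul _),
    integral_add (integrable_const _) (hDi.const_mul _), integral_const_mul, integral_const_mul,
    hmean, integral_const, probReal_univ]
  have : t ^ 2 * ∫ ω, (Y ω ^ 2 + 1) ^ 2 * Real.exp ((Y ω ^ 2 + 1) / 8) ∂P ≤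
      t ^ 2 * bernsteinConst := by gcongr
  simp only [smul_eq_mul, mul_one, mul_zero, add_zero]
  linarith [Real.add_one_le_exp (bernsteinConst * t ^ 2)]

theorem measureReal_sum_ge_le {Ω : Type*} [MeasurableSpace Ω] {P : Measure Ω}
    [IsProbabilityMeasure P] {ℓ : ℕ} {D Y : Fin ℓ → Ω → ℝ} (hind : iIndepFun D P)
    (hD : ∀ i, AEMeasurable (D i) P) (hY : ∀ i, HasLaw (Y i) (gaussianReal 0 1) P)
    (hDY : ∀ i ω, |D i ω| ≤ Y i ω ^ 2 + 1) (hmean : ∀ i, ∫ ω, D i ω ∂P = 0) {ε : ℝ} (h0 : 0 < ε)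
    (h1 : ε ≤ 1) :
    P.real {ω | ε * ℓ ≤ ∑ i, D i ω} ≤ Real.exp (-(ε ^ 2 / (4 * bernsteinConst) * ℓ)) := by
  have hK := four_le_bernsteinConst
  have hK0 : 0 < bernsteinConst := by linarith
  -- This `t` minimizes the Chernoff exponent `-tε + bernsteinConst * t²`. The summand `4` in
  -- `bernsteinConst` guarantees `t ≤ 1/8`.
  set t : ℝ := ε / (2 * bernsteinConst) with ht
  have ht0 : 0 ≤ t := by positivity
  have ht8 : |t| ≤ 1 / 8 := by
    rw [abs_of_nonneg ht0, ht, div_le_div_iff₀ (by positivity) (by norm_num)]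
    linarith
  have hm := fun i => mgf_le_of_abs_le (hD i) (hY i) (hDY i) (hmean i) ht8
  have hprod : mgf (fun ω => ∑ i, D i ω) P t = ∏ i, mgf (D i) P t := by
    have h3 : (∑ i, D i) = fun ω => ∑ i, D i ω := by ext; simp
    rw [← h3]
    exact hind.mgf_sum₀ hD Finset.univ
  have hsum : mgf (fun ω => ∑ i, D i ω) P t ≤ Real.exp (bernsteinConst * t ^ 2 * ℓ) := by
    rw [hprod]
    refine (Finset.prod_le_prod (fun i _ => mgf_nonneg) fun i _ => (hm i).2).trans_eq ?_
    rw [Finset.prod_const, Finset.card_univ, Fintype.card_fin, ← Real.exp_nat_mul, mul_comm]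
  have hint : Integrable (fun ω => Real.exp (t * ∑ i, D i ω)) P := by
    -- Without integrability the moment generating function would take the default value `0`, yet it
    -- is a product of positive factors.
    by_contra h
    rw [mgf_undef h] at hprod
    exact (Finset.prod_pos fun i _ => mgf_pos (hm i).1).ne hprod
  refine (measure_ge_le_exp_mul_mgf _ ht0 hint).trans ?_
  refine (mul_le_mul_of_nonneg_left hsum (Real.exp_pos _).le).trans_eq ?_
  rw [← Real.exp_add, ht]
  congr 1
  field_simp
  ring

theorem measureReal_abs_sum_sub_ge_le {Ω : Type*} [MeasurableSpace Ω] {P : Measure Ω}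
    [IsProbabilityMeasure P] {ℓ : ℕ} {X Y : Fin ℓ → Ω → ℝ} (hind : iIndepFun X P)
    (hX : ∀ i, AEMeasurable (X i) P) (hY : ∀ i, HasLaw (Y i) (gaussianReal 0 1) P)
    (h0 : ∀ i ω, 0 ≤ X i ω) (hXY : ∀ i ω, X i ω ≤ Y i ω ^ 2) {m : ℝ}
    (hmean : ∀ i, ∫ ω, X i ω ∂P = m) {ε : ℝ} (hε0 : 0 < ε) (hε1 : ε ≤ 1) :
    P.real {ω | ε * ℓ ≤ |∑ i, X i ω - ℓ * m|} ≤
      2 * Real.exp (-(ε ^ 2 / (4 * bernsteinConst) * ℓ)) := by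
  have hXi : ∀ i, Integrable (X i) P := fun i =>
    (integral_sq_of_hasLaw (hY i)).1.mono' (hX i).aestronglyMeasurable
      (.of_forall fun ω => by rw [Real.norm_of_nonneg (h0 i ω)]; exact hXY i ω)
  -- The quantifier over `Fin ℓ` is needed: for `ℓ = 0` nothing constrains `m`.
  have hm : ∀ _ : Fin ℓ, 0 ≤ m ∧ m ≤ 1 := fun i => by
    rw [← hmean i]
    refine ⟨integral_nonneg (h0 i), ?_⟩
    rw [← (integral_sq_of_hasLaw (hY i)).2]
    exact integral_mono (hXi i) (integral_sq_of_hasLaw (hY i)).1 (hXY i)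
  have habs : ∀ i ω, |X i ω - m| ≤ Y i ω ^ 2 + 1 := fun i ω => by
    rw [abs_le]
    constructor <;> nlinarith [hm i, h0 i ω, hXY i ω, sq_nonneg (Y i ω)]
  have hmz : ∀ i, ∫ ω, (X i ω - m) ∂P = 0 := fun i => by
    rw [integral_sub (hXi i) (integrable_const _), hmean i]; simp
  have up := measureReal_sum_ge_le (D := fun i ω => X i ω - m) (Y := Y) (ε := ε)
    (hind.comp (fun _ s => s - m) (by fun_prop)) (fun i => (hX i).sub_const m) hY habs hmz hε0 hε1
  have dn := measureReal_sum_ge_le (D := fun i ω => m - X i ω) (Y := Y) (ε := ε)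
    (hind.comp (fun _ s => m - s) (by fun_prop)) (fun i => (hX i).const_sub m) hY
    (fun i ω => by rw [abs_sub_comm]; exact habs i ω)
    (fun i => by
      have := hmz i
      rw [← neg_inj, ← integral_neg] at this
      simpa using this) hε0 hε1
  have hsub : {ω | ε * ℓ ≤ |∑ i, X i ω - ℓ * m|} ⊆
      {ω | ε * ℓ ≤ ∑ i, (X i ω - m)} ∪ {ω | ε * ℓ ≤ ∑ i, (m - X i ω)} := by
    intro ω hω
    simp only [Set.mem_ofPred_eq, Set.mem_union, Finset.sum_sub_distrib, Finset.sum_const,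
      Finset.card_univ, Fintype.card_fin, nsmul_eq_mul] at hω ⊢
    rcases le_abs.1 hω with h | h
    · exact .inl h
    · exact .inr (by linarith)
  calc _ ≤ _ := measureReal_mono hsub
    _ ≤ _ := measureReal_union_le _ _
    _ ≤ _ := by linarith

/-! ### A net of the unit sphere -/

/-- Cut the cube into cells of side `δ/n` and choose one unit vector in each cell that contains one.
Two points of a cell are within `√n · δ/n ≤ δ`. A volumetric count would save only a power of `n`
per dimension, which affects constants alone when `ℓ` exceeds a multiple of `n log n`. -/
theorem exists_finset_sphere_net {n : ℕ} (hn : 1 ≤ n) {δ : ℝ} (hδ0 : 0 < δ) (hδ1 : δ ≤ 1) :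
    ∃ T : Finset (EuclideanSpace ℝ (Fin n)), (∀ t ∈ T, ‖t‖ = 1) ∧
      (T.card : ℝ) ≤ (5 * n / δ) ^ n ∧ ∀ x, ‖x‖ = 1 → ∃ t ∈ T, ‖x - t‖ ≤ δ := by
  classical
  have hn1 : (1 : ℝ) ≤ n := by exact_mod_cast hn
  set h : ℝ := n / δ with hh
  have hh1 : 1 ≤ h := by rw [hh, le_div_iff₀ hδ0]; linarith
  set q : EuclideanSpace ℝ (Fin n) → Fin n → ℤ := fun x i => ⌊x i * h⌋ with hq
  set N : ℕ := ⌈h⌉₊ with hN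
  set cells : Finset (Fin n → ℤ) := Fintype.piFinset fun _ => Finset.Icc (-(N : ℤ)) N with hcells
  have hcard : cells.card = (2 * N + 1) ^ n := by
    rw [hcells, Fintype.card_piFinset_const, Int.card_Icc]
    congr 1
    omega
  have hmem : ∀ x : EuclideanSpace ℝ (Fin n), ‖x‖ = 1 → q x ∈ cells := by
    intro x hx
    rw [hcells, Fintype.mem_piFinset]
    intro i
    have h1 : |x i| ≤ 1 := by rw [← hx]; exact PiLp.norm_apply_le x i
    have h2 : h ≤ N := Nat.le_ceil h
    have h3 : |x i * h| ≤ h := by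
      rw [abs_mul, abs_of_nonneg (zero_le_one.trans hh1)]
      exact mul_le_of_le_one_left (zero_le_one.trans hh1) h1
    rw [abs_le] at h3
    rw [Finset.mem_Icc]
    constructor
    · rw [Int.le_floor]; push_cast; linarith
    · exact Int.floor_le_iff.2 (by push_cast; linarith)
  set rep : (Fin n → ℤ) → EuclideanSpace ℝ (Fin n) := fun c =>
    if hc : ∃ x, ‖x‖ = 1 ∧ q x = c then hc.choose else 0 with hrep
  set used := cells.filter fun c => ∃ x, ‖x‖ = 1 ∧ q x = c with hused
  have hrep1 : ∀ c, (∃ x, ‖x‖ = 1 ∧ q x = c) → ‖rep c‖ = 1 ∧ q (rep c) = c := by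
    intro c hc
    simp only [hrep, dif_pos hc]
    exact hc.choose_spec
  refine ⟨used.image rep, ?_, ?_, ?_⟩
  · intro t ht
    obtain ⟨c, hc, rfl⟩ := Finset.mem_image.1 ht
    exact (hrep1 c (Finset.mem_filter.1 hc).2).1
  · have h1 : (used.image rep).card ≤ (2 * N + 1) ^ n :=
      Finset.card_image_le.trans ((Finset.card_filter_le _ _).trans_eq hcard)
    have h2 : ((used.image rep).card : ℝ) ≤ (2 * N + 1) ^ n := by exact_mod_cast h1
    refine h2.trans (pow_le_pow_left₀ (by positivity) ?_ n)
    -- Hence `2N + 1 < 2h + 3 ≤ 5h`, as `h ≥ 1`.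
    have h3 : (N : ℝ) < h + 1 := Nat.ceil_lt_add_one (by linarith)
    rw [mul_div_assoc, ← hh]
    linarith
  · intro x hx
    have hex : ∃ z, ‖z‖ = 1 ∧ q z = q x := ⟨x, hx, rfl⟩
    refine ⟨rep (q x), Finset.mem_image_of_mem _ (Finset.mem_filter.2 ⟨hmem x hx, hex⟩), ?_⟩
    have hqe := (hrep1 _ hex).2
    set t := rep (q x)
    have hcoord : ∀ i, ((x - t) i) ^ 2 ≤ (δ / n) ^ 2 := by
      intro i
      have h1 : |x i * h - t i * h| < 1 :=
        Int.abs_sub_lt_one_of_floor_eq_floor (congrFun hqe i).symm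
      rw [← sub_mul, abs_mul, abs_of_nonneg (zero_le_one.trans hh1), ← lt_div_iff₀ (by linarith),
        hh, one_div_div] at h1
      exact sq_le_sq.2 (h1.le.trans (le_abs_self _))
    have hsq : ‖x - t‖ ^ 2 ≤ δ ^ 2 := by
      rw [EuclideanSpace.real_norm_sq_eq]
      refine (Finset.sum_le_sum fun i _ => hcoord i).trans ?_
      rw [Finset.sum_const, Finset.card_univ, Fintype.card_fin, nsmul_eq_mul, div_pow,
        mul_div_assoc', div_le_iff₀ (by positivity)]
      nlinarith [mul_le_mul_of_nonneg_left hn1 (mul_nonneg (sq_nonneg δ) (zero_le_one.trans hn1))]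
    exact (pow_le_pow_iff_left₀ (norm_nonneg _) hδ0.le two_ne_zero).1 hsq

/-! ### Slab estimates and passage from the net to the sphere -/

theorem measureReal_abs_le_gaussianReal {η : ℝ} (hη : 0 ≤ η) :
    (gaussianReal 0 1).real {t | |t| ≤ η} ≤ η := by
  have hset : {t : ℝ | |t| ≤ η} = Set.Icc (-η) η := by ext t; simp [abs_le]
  rw [measureReal_def, gaussianReal_apply_eq_integral _ one_ne_zero, ENNReal.toReal_ofReal
    (integral_nonneg fun t => gaussianPDFReal_nonneg _ _ _), hset]
  have hle : ∀ t : ℝ, gaussianPDFReal 0 1 t ≤ 1 / 2 := by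
    intro t
    have h1 : (2 : ℝ) ≤ Real.sqrt (2 * Real.pi) :=
      Real.le_sqrt_of_sq_le (by nlinarith [Real.two_le_pi])
    have h2 : (Real.sqrt (2 * Real.pi))⁻¹ ≤ 1 / 2 := by
      rw [one_div]; exact inv_anti₀ two_pos h1
    have h3 : Real.exp (-t ^ 2 / 2) ≤ 1 := Real.exp_le_one_iff.2 (by nlinarith [sq_nonneg t])
    simp only [gaussianPDFReal_def, NNReal.coe_one, mul_one, sub_zero]
    calc _ ≤ (1 / 2 : ℝ) * 1 := mul_le_mul h2 h3 (Real.exp_pos _).le (by norm_num)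
      _ = _ := mul_one _
  refine (setIntegral_mono_on (integrable_gaussianPDFReal 0 1).integrableOn
    (integrableOn_const (by simp) ) measurableSet_Icc fun t _ => hle t).trans ?_
  simp [hη]
  linarith

theorem integral_pow_four_gaussianReal_le :
    Integrable (fun t : ℝ => t ^ 4) (gaussianReal 0 1) ∧
      ∫ t, t ^ 4 ∂(gaussianReal 0 1) ≤ bernsteinConst := by
  have hle : ∀ t : ℝ, t ^ 4 ≤ (t ^ 2 + 1) ^ 2 * Real.exp ((t ^ 2 + 1) / 8) := fun t =>
    calc t ^ 4 ≤ (t ^ 2 + 1) ^ 2 * 1 := by nlinarith [sq_nonneg t]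
      _ ≤ _ := by gcongr; exact Real.one_le_exp (by positivity)
  have hi : Integrable (fun t : ℝ => t ^ 4) (gaussianReal 0 1) :=
    integrable_bernstein_gaussianReal.mono' (by fun_prop)
      (.of_forall fun t => by rw [Real.norm_of_nonneg (by positivity)]; exact hle t)
  refine ⟨hi, (integral_mono hi integrable_bernstein_gaussianReal hle).trans ?_⟩
  rw [bernsteinConst]
  linarith

/-- Integrate `s² ≤ M + s⁴/M` over the slab, which has measure at most `η`; the fourth moment is at
most `bernsteinConst`. No relation between `x` and `u` is needed, and `M` is free to balance the two
terms. -/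
theorem setIntegral_slab_sq_le {n : ℕ} {x u : EuclideanSpace ℝ (Fin n)} (hx : ‖x‖ = 1)
    (hu : ‖u‖ = 1) {η M : ℝ} (hη : 0 ≤ η) (hM : 0 < M) :
    ∫ g in {g | |inner ℝ x g| ≤ η}, inner ℝ u g ^ 2 ∂(stdGaussian (EuclideanSpace ℝ (Fin n))) ≤
      M * η + bernsteinConst / M := by
  set μ := stdGaussian (EuclideanSpace ℝ (Fin n))
  have hux := hasLaw_inner_stdGaussian hu
  have hxx := hasLaw_inner_stdGaussian hx
  have hS : MeasurableSet {g : EuclideanSpace ℝ (Fin n) | |inner ℝ x g| ≤ η} :=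
    measurableSet_le (by fun_prop : Measurable fun g => |inner ℝ x g|) measurable_const
  have h4 : Integrable (fun g => inner ℝ u g ^ 4) μ := by
    have h := integral_pow_four_gaussianReal_le.1
    rw [← hux.map_eq] at h
    exact h.comp_aemeasurable hux.aemeasurable
  have h4le : ∫ g, inner ℝ u g ^ 4 ∂μ ≤ bernsteinConst :=
    (hux.integral_comp integral_pow_four_gaussianReal_le.1.1).trans_le
      integral_pow_four_gaussianReal_le.2
  have h2 : Integrable (fun g => inner ℝ u g ^ 2) μ := (integral_sq_of_hasLaw hux).1
  have hpt : ∀ g : EuclideanSpace ℝ (Fin n), inner ℝ u g ^ 2 ≤ M + inner ℝ u g ^ 4 / M := by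
    intro g
    generalize (inner ℝ u g : ℝ) = t
    have h : M + t ^ 4 / M - t ^ 2 = (M ^ 2 + t ^ 4 - M * t ^ 2) / M := by field_simp
    rw [← sub_nonneg, h]
    exact div_nonneg (by nlinarith [sq_nonneg (M - t ^ 2), sq_nonneg (M + t ^ 2)]) hM.le
  have hmeas : μ.real {g | |inner ℝ x g| ≤ η} ≤ η :=
    (hxx.measureReal_eq (p := fun t => |t| ≤ η)
      (measurableSet_le (by fun_prop) measurable_const)).trans_le
      (measureReal_abs_le_gaussianReal hη)
  calc _ ≤ ∫ g in {g | |inner ℝ x g| ≤ η}, (M + inner ℝ u g ^ 4 / M) ∂μ :=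
        setIntegral_mono h2.integrableOn
          ((integrable_const M).add (h4.div_const M)).integrableOn hpt
    _ = M * μ.real {g | |inner ℝ x g| ≤ η} +
        (∫ g in {g | |inner ℝ x g| ≤ η}, inner ℝ u g ^ 4 ∂μ) / M := by
        rw [integral_add (integrable_const M) (h4.div_const M).integrableOn, integral_div,
          setIntegral_const, smul_eq_mul, mul_comm]
    _ ≤ _ := by
        have := (setIntegral_le_integral (s := {g | |inner ℝ x g| ≤ η}) h4
          (.of_forall fun g => by positivity)).trans h4le
        gcongr

theorem coneSq_nonneg {n : ℕ} (R τ : ℝ) (x y u g : EuclideanSpace ℝ (Fin n)) :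
    0 ≤ coneSq R τ x y u g :=
  Set.indicator_nonneg (fun _ _ => sq_nonneg _) _

theorem coneSq_le {n : ℕ} (R τ : ℝ) (x y u g : EuclideanSpace ℝ (Fin n)) :
    coneSq R τ x y u g ≤ inner ℝ u g ^ 2 :=
  Set.indicator_le_self' (fun _ _ => sq_nonneg _) _

theorem measurable_coneSq {n : ℕ} (R τ : ℝ) (x y u : EuclideanSpace ℝ (Fin n)) :
    Measurable (coneSq R τ x y u) :=
  Measurable.indicator (by fun_prop) (measurableSet_cone R τ x y)

theorem integrable_coneSq {n : ℕ} (R τ : ℝ) (x y : EuclideanSpace ℝ (Fin n))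
    {u : EuclideanSpace ℝ (Fin n)} (hu : ‖u‖ = 1) :
    Integrable (coneSq R τ x y u) (stdGaussian (EuclideanSpace ℝ (Fin n))) :=
  (integral_sq_of_hasLaw (hasLaw_inner_stdGaussian hu)).1.mono'
    (measurable_coneSq R τ x y u).aestronglyMeasurable
    (.of_forall fun g => by
      rw [Real.norm_of_nonneg (coneSq_nonneg ..)]; exact coneSq_le ..)

/-- A point of the enlarged cone outside the shrunken one has `|x·g| ≤ η` or `|y·g| ≤ η`, so two
slabs cover the gap. -/
theorem integral_coneSq_gap_le {n : ℕ} {x y u : EuclideanSpace ℝ (Fin n)} (hx : ‖x‖ = 1)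
    (hy : ‖y‖ = 1) (hu : ‖u‖ = 1) (R : ℝ) {η M : ℝ} (hη : 0 ≤ η) (hM : 0 < M) :
    ∫ g, coneSq R (-η) x y u g ∂(stdGaussian (EuclideanSpace ℝ (Fin n))) ≤
      ∫ g, coneSq R η x y u g ∂(stdGaussian (EuclideanSpace ℝ (Fin n))) +
        2 * (M * η + bernsteinConst / M) := by
  set μ := stdGaussian (EuclideanSpace ℝ (Fin n))
  have h2 : Integrable (fun g => inner ℝ u g ^ 2) μ :=
    (integral_sq_of_hasLaw (hasLaw_inner_stdGaussian hu)).1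
  have hS : ∀ x : EuclideanSpace ℝ (Fin n), MeasurableSet {g | |inner ℝ x g| ≤ η} := fun x =>
    measurableSet_le (by fun_prop : Measurable fun g => |inner ℝ x g|) measurable_const
  have hpt : ∀ g, coneSq R (-η) x y u g ≤ coneSq R η x y u g +
      ({g | |inner ℝ x g| ≤ η}.indicator (fun g => inner ℝ u g ^ 2) g +
        {g | |inner ℝ y g| ≤ η}.indicator (fun g => inner ℝ u g ^ 2) g) := by
    intro g
    simp only [coneSq, Set.indicator_apply, Set.mem_ofPred_eq, abs_le]
    have h0 := sq_nonneg (inner ℝ u g)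
    split_ifs with h1 h2 h3 h4 <;> try linarith
    exfalso
    grind
  have hi : ∀ x : EuclideanSpace ℝ (Fin n),
      Integrable ({g | |inner ℝ x g| ≤ η}.indicator fun g => inner ℝ u g ^ 2) μ :=
    fun x => h2.indicator (hS x)
  have hmono := integral_mono (integrable_coneSq R (-η) x y hu)
    ((integrable_coneSq R η x y hu).add ((hi x).add (hi y))) hpt
  rw [integral_add' (integrable_coneSq R η x y hu) ((hi x).add (hi y)),
    integral_add' (hi x) (hi y), integral_indicator (hS x),
    integral_indicator (hS y)] at hmono
  linarith [setIntegral_slab_sq_le hx hu hη hM, setIntegral_slab_sq_le hy hu hη hM]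

/-- The indicator bounds between a point of the sphere and a nearby net point. -/
theorem coneSq_sandwich {n : ℕ} {x x' y y' u u' : EuclideanSpace ℝ (Fin n)} {R δ : ℝ}
    (hδ : 0 ≤ δ) (hu : ‖u‖ = 1) (hu' : ‖u'‖ = 1) (hxx : ‖x - x'‖ ≤ δ) (hyy : ‖y - y'‖ ≤ δ)
    (huu : ‖u - u'‖ ≤ δ) (g : EuclideanSpace ℝ (Fin n)) :
    coneSq R (R * δ) x' y' u' g - 2 * R ^ 2 * δ ≤ coneSq R 0 x y u g ∧
      coneSq R 0 x y u g ≤ coneSq R (-(R * δ)) x' y' u' g + 2 * R ^ 2 * δ := by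
  have hκ : 0 ≤ 2 * R ^ 2 * δ := by positivity
  by_cases hg : ‖g‖ ≤ R
  · have hR : 0 ≤ R := (norm_nonneg g).trans hg
    have key : ∀ a b : EuclideanSpace ℝ (Fin n), ‖a - b‖ ≤ δ →
        |inner ℝ a g - inner ℝ b g| ≤ R * δ := by
      intro a b hab
      rw [← inner_sub_left, mul_comm]
      exact (abs_real_inner_le_norm _ _).trans (mul_le_mul hab hg (norm_nonneg _) hδ)
    have hx := abs_le.1 (key x x' hxx)
    have hy := abs_le.1 (key y y' hyy)
    -- Difference of squares: the sum is at most `2R` and the difference at most `Rδ`.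
    have hsq : |inner ℝ u g ^ 2 - inner ℝ u' g ^ 2| ≤ 2 * R ^ 2 * δ := by
      have h1 := key u u' huu
      have h2 : |inner ℝ u g + inner ℝ u' g| ≤ 2 * R := by
        have a1 := abs_real_inner_le_norm u g
        have a2 := abs_real_inner_le_norm u' g
        rw [hu, one_mul] at a1
        rw [hu', one_mul] at a2
        linarith [abs_add_le (inner ℝ u g) (inner ℝ u' g)]
      rw [sq_sub_sq, abs_mul]
      calc _ ≤ 2 * R * (R * δ) := mul_le_mul h2 h1 (abs_nonneg _) (by positivity)
        _ = _ := by ring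
    have hs := abs_le.1 hsq
    have n1 := sq_nonneg (inner ℝ u g)
    have n2 := sq_nonneg (inner ℝ u' g)
    simp only [coneSq, Set.indicator_apply, Set.mem_ofPred_eq, hg, and_true]
    constructor
    · split_ifs with h1 h2 <;> try linarith
      exact absurd ⟨by linarith, by linarith⟩ h2
    · split_ifs with h1 h2 <;> try linarith
      exact absurd ⟨by linarith, by linarith⟩ h2
  · simp only [coneSq, Set.indicator_apply, Set.mem_ofPred_eq, hg, and_false, if_false]
    constructor <;> linarith

/-- Closeness of the empirical means to the expectations at the points of a net implies closeness
on the whole sphere. -/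
theorem abs_sum_coneSq_sub_le_of_net {n ℓ : ℕ} (hn : 1 ≤ n) {ε δ : ℝ} (hε0 : 0 < ε) (hε1 : ε ≤ 1)
    (hδ : δ = ε ^ 2 / (768 * bernsteinConst * n)) {T : Finset (EuclideanSpace ℝ (Fin n))}
    (hT1 : ∀ t ∈ T, ‖t‖ = 1) (hT : ∀ x, ‖x‖ = 1 → ∃ t ∈ T, ‖x - t‖ ≤ δ)
    {g : Fin ℓ → EuclideanSpace ℝ (Fin n)}
    (hg : ∀ x ∈ T, ∀ y ∈ T, ∀ u ∈ T,
      ∀ τ ∈ ({3 * Real.sqrt n * δ, -(3 * Real.sqrt n * δ)} : Finset ℝ),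
        |∑ i, coneSq (3 * Real.sqrt n) τ x y u (g i) - ℓ * ∫ g, coneSq (3 * Real.sqrt n) τ x y u g
          ∂(stdGaussian (EuclideanSpace ℝ (Fin n)))| ≤ ε / 4 * ℓ)
    {x y u : EuclideanSpace ℝ (Fin n)} (hx : ‖x‖ = 1) (hy : ‖y‖ = 1) (hu : ‖u‖ = 1) :
    |∑ i, coneSq (3 * Real.sqrt n) 0 x y u (g i) - ℓ * ∫ g, coneSq (3 * Real.sqrt n) 0 x y u g
      ∂(stdGaussian (EuclideanSpace ℝ (Fin n)))| ≤ ε * ℓ := by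
  have hK := four_le_bernsteinConst
  have hK0 : 0 < bernsteinConst := by linarith
  have hn1 : (1 : ℝ) ≤ n := by exact_mod_cast hn
  have hδ0 : 0 ≤ δ := by rw [hδ]; positivity
  obtain ⟨x', hx', hxx⟩ := hT x hx
  obtain ⟨y', hy', hyy⟩ := hT y hy
  obtain ⟨u', hu', huu⟩ := hT u hu
  set R : ℝ := 3 * Real.sqrt n with hR
  have hR2 : R ^ 2 = 9 * n := by rw [hR, mul_pow, Real.sq_sqrt (by positivity)]; norm_num
  have hsw := coneSq_sandwich (R := R) hδ0 hu (hT1 u' hu') hxx hyy huu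
  have hnδ : n * δ = ε ^ 2 / (768 * bernsteinConst) := by
    rw [hδ]; field_simp
  have hnδ' : n * δ ≤ ε / 3072 := by
    rw [hnδ, div_le_div_iff₀ (by positivity) (by norm_num)]
    nlinarith
  have hη0 : 0 ≤ R * δ := by positivity
  have hη : R * δ ≤ ε ^ 2 / (256 * bernsteinConst) := by
    have h1 : Real.sqrt n ≤ n := Real.sqrt_le_self_iff.2 (.inr hn1)
    calc R * δ ≤ 3 * n * δ := by rw [hR]; gcongr
      _ = 3 * (n * δ) := by ring
      _ = _ := by rw [hnδ]; field_simp; norm_num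
  -- This value of `M` bounds both slab terms by `ε/16`, so the gap costs at most `ε/4`.
  have hM : 0 < 16 * bernsteinConst / ε := by positivity
  have hgap := integral_coneSq_gap_le (hT1 x' hx') (hT1 y' hy') (hT1 u' hu') R hη0 hM
  have hgap' : 2 * (16 * bernsteinConst / ε * (R * δ) + bernsteinConst /
      (16 * bernsteinConst / ε)) ≤ ε / 4 := by
    have h1 : 16 * bernsteinConst / ε * (R * δ) ≤
        16 * bernsteinConst / ε * (ε ^ 2 / (256 * bernsteinConst)) := by gcongr
    have h2 : 16 * bernsteinConst / ε * (ε ^ 2 / (256 * bernsteinConst)) = ε / 16 := by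
      field_simp; norm_num
    have h3 : bernsteinConst / (16 * bernsteinConst / ε) = ε / 16 := by field_simp
    linarith
  have hp := abs_le.1 (hg x' hx' y' hy' u' hu' (R * δ) (by simp))
  have hm := abs_le.1 (hg x' hx' y' hy' u' hu' (-(R * δ)) (by simp))
  have hi := fun τ x y => integrable_coneSq R τ x y hu
  have hi' := fun τ x y => integrable_coneSq R τ x y (hT1 u' hu')
  have hI1 := integral_mono ((hi' (R * δ) x' y').sub (integrable_const (2 * R ^ 2 * δ)))
    (hi 0 x y) fun g => (hsw g).1
  have hI2 := integral_mono (hi 0 x y)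
    ((hi' (-(R * δ)) x' y').add (integrable_const (2 * R ^ 2 * δ))) fun g => (hsw g).2
  rw [integral_sub' (hi' _ _ _) (integrable_const _), integral_const, probReal_univ,
    one_smul] at hI1
  rw [integral_add' (hi' _ _ _) (integrable_const _), integral_const, probReal_univ,
    one_smul] at hI2
  have hS1 := Finset.sum_le_sum (s := Finset.univ) fun i _ => (hsw (g i)).1
  have hS2 := Finset.sum_le_sum (s := Finset.univ) fun i _ => (hsw (g i)).2
  rw [Finset.sum_sub_distrib, Finset.sum_const, Finset.card_univ, Fintype.card_fin,
    nsmul_eq_mul] at hS1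
  rw [Finset.sum_add_distrib, Finset.sum_const, Finset.card_univ, Fintype.card_fin,
    nsmul_eq_mul] at hS2
  have hκ : 2 * R ^ 2 * δ ≤ ε / 8 := by rw [hR2]; linarith
  have hℓ : (0 : ℝ) ≤ ℓ := Nat.cast_nonneg ℓ
  generalize (∫ g, coneSq R 0 x y u g ∂(stdGaussian (EuclideanSpace ℝ (Fin n)))) = I0 at *
  generalize (∫ g, coneSq R (R * δ) x' y' u' g ∂(stdGaussian (EuclideanSpace ℝ (Fin n)))) = Ip
    at *
  generalize (∫ g, coneSq R (-(R * δ)) x' y' u' g ∂(stdGaussian (EuclideanSpace ℝ (Fin n)))) = Im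
    at *
  have k1 : ℓ * Im ≤ ℓ * (I0 + 2 * R ^ 2 * δ + ε / 4) := by gcongr; linarith
  have k2 : ℓ * (I0 - 2 * R ^ 2 * δ - ε / 4) ≤ ℓ * Ip := by gcongr; linarith
  have k3 : ℓ * (2 * R ^ 2 * δ) ≤ ℓ * (ε / 8) := by gcongr
  -- The error per sample is at most `ε/4` from concentration, `ε/4` from the gap, and `ε/8` twice
  -- from the sandwich, for the sum and for the mean: `3ε/4` in total.
  rw [abs_le]
  constructor <;> nlinarith

/-! ### From quadratic forms to the Weight Distribution Condition -/

theorem norm_toEuclideanCLM_le {n : ℕ} {A : Matrix (Fin n) (Fin n) ℝ} (hA : A.IsHermitian)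
    {ε : ℝ} (hε : 0 ≤ ε) (h : ∀ u : EuclideanSpace ℝ (Fin n), ‖u‖ = 1 →
      |inner ℝ u (Matrix.toEuclideanCLM (n := Fin n) (𝕜 := ℝ) A u)| ≤ ε) :
    ‖Matrix.toEuclideanCLM (n := Fin n) (𝕜 := ℝ) A‖ ≤ ε := by
  rw [ContinuousLinearMap.norm_eq_iSup_rayleighQuotient _
    (Matrix.isSymmetric_toEuclideanLin_iff.2 hA)]
  refine ciSup_le fun x => ?_
  by_cases hx : x = 0
  · simp [hx, hε]
  · have hx' : ‖x‖⁻¹ ≠ 0 := inv_ne_zero (norm_ne_zero_iff.2 hx)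
    rw [← ContinuousLinearMap.rayleigh_smul _ x hx']
    have hn : ‖‖x‖⁻¹ • x‖ = 1 := by simp [norm_smul, hx]
    have := h _ hn
    rw [ContinuousLinearMap.rayleighQuotient, hn, ContinuousLinearMap.reApplyInnerSelf_apply,
      real_inner_comm]
    simpa using this

theorem isHermitian_vecMulVec_self {n : ℕ} (v : Fin n → ℝ) :
    (Matrix.vecMulVec v v).IsHermitian := by
  rw [Matrix.IsHermitian, Matrix.conjTranspose_eq_transpose_of_trivial, Matrix.transpose_vecMulVec]

theorem isHermitian_QMatrix {n : ℕ} (x y : EuclideanSpace ℝ (Fin n)) :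
    (QMatrix x y).IsHermitian := by
  have hl : ∀ v : EuclideanSpace ℝ (Fin n), (lineProj v).IsHermitian := fun v =>
    (isHermitian_vecMulVec_self v.ofLp).smul (.all _)
  exact (Matrix.isHermitian_one.smul (.all _)).add (((hl _).sub (hl _)).smul (.all _))

theorem isHermitian_activeGram {ℓ n : ℕ} (W : Matrix (Fin ℓ) (Fin n) ℝ)
    (x y : EuclideanSpace ℝ (Fin n)) : (activeGram W x y).IsHermitian := by
  refine isSelfAdjoint_sum (R := Matrix (Fin n) (Fin n) ℝ) _ fun i _ => ?_
  exact ((isHermitian_vecMulVec_self (W i)).smul (.all _)).smul (.all _)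

theorem activeGram_unitVec {ℓ n : ℕ} (W : Matrix (Fin ℓ) (Fin n) ℝ)
    {x y : EuclideanSpace ℝ (Fin n)} (hx : x ≠ 0) (hy : y ≠ 0) :
    activeGram W (unitVec x) (unitVec y) = activeGram W x y := by
  have h : ∀ (x : EuclideanSpace ℝ (Fin n)), x ≠ 0 → ∀ i,
      (0 < W i ⬝ᵥ (unitVec x).ofLp ↔ 0 < W i ⬝ᵥ x.ofLp) := fun x hx i => by
    rw [unitVec, WithLp.ofLp_smul, dotProduct_smul, smul_eq_mul,
      mul_pos_iff_of_pos_left (inv_pos.2 (norm_pos_iff.2 hx))]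
  simp only [activeGram, h x hx, h y hy]

theorem QMatrix_unitVec {n : ℕ} {x y : EuclideanSpace ℝ (Fin n)} (hx : x ≠ 0) (hy : y ≠ 0) :
    QMatrix (unitVec x) (unitVec y) = QMatrix x y := by
  have hu : ∀ x : EuclideanSpace ℝ (Fin n), x ≠ 0 → unitVec (unitVec x) = unitVec x := fun x hx => by
    rw [unitVec, norm_unitVec hx, inv_one, one_smul]
  have ha : InnerProductGeometry.angle (unitVec x) (unitVec y) =
      InnerProductGeometry.angle x y := by
    rw [unitVec, unitVec, InnerProductGeometry.angle_smul_left_of_pos _ _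
      (inv_pos.2 (norm_pos_iff.2 hx)), InnerProductGeometry.angle_smul_right_of_pos _ _
      (inv_pos.2 (norm_pos_iff.2 hy))]
  rw [QMatrix, QMatrix, ha, swapMatrix, swapMatrix, hu x hx, hu y hy]

/-- Rescaling by `√ℓ` preserves the half-spaces, turns the cutoff `3√(n/ℓ)` into `3√n`, and
multiplies the squares by `ℓ`. -/
theorem inner_toEuclideanCLM_activeGram {ℓ n : ℕ} (hℓ : 0 < ℓ)
    (w : Fin ℓ → EuclideanSpace ℝ (Fin n)) (x y u : EuclideanSpace ℝ (Fin n)) :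
    ℓ * inner ℝ u (Matrix.toEuclideanCLM (n := Fin n) (𝕜 := ℝ) (activeGram (truncMatrix w) x y) u) =
      ∑ i, coneSq (3 * Real.sqrt n) 0 x y u (Real.sqrt ℓ • w i) := by
  have hℓ0 : (0 : ℝ) < ℓ := by exact_mod_cast hℓ
  have hs : 0 < Real.sqrt ℓ := Real.sqrt_pos.2 hℓ0
  have hdot : ∀ v z : EuclideanSpace ℝ (Fin n), v.ofLp ⬝ᵥ z.ofLp = inner ℝ z v := fun v z => by
    simp [PiLp.inner_apply, dotProduct]
  have hquad : ∀ v : EuclideanSpace ℝ (Fin n), inner ℝ u (Matrix.toEuclideanCLM (n := Fin n)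
      (𝕜 := ℝ) (Matrix.vecMulVec v.ofLp v.ofLp) u) = inner ℝ u v ^ 2 := fun v => by
    rw [Matrix.inner_toEuclideanCLM, Matrix.vecMulVec_mulVec, op_smul_eq_smul, dotProduct_smul,
      hdot, hdot, smul_eq_mul, real_inner_comm u v]
    ring
  simp only [activeGram, map_sum, map_smul, sum_apply, smul_apply, inner_sum,
    real_inner_smul_right]
  rw [Finset.mul_sum]
  refine Finset.sum_congr rfl fun i _ => ?_
  have hrow : truncMatrix w i = (truncVec (3 * Real.sqrt ((n : ℝ) / ℓ)) (w i)).ofLp := rfl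
  rw [hrow, hquad, hdot, hdot]
  have hnorm : ‖Real.sqrt ℓ • w i‖ ≤ 3 * Real.sqrt n ↔ ‖w i‖ ≤ 3 * Real.sqrt ((n : ℝ) / ℓ) := by
    rw [norm_smul, Real.norm_of_nonneg hs.le, Real.sqrt_div' _ hℓ0.le, mul_div_assoc',
      le_div_iff₀ hs, mul_comm]
  simp only [coneSq, truncVec, Set.indicator_apply, Set.mem_ofPred_eq, hnorm,
    real_inner_smul_right, mul_pos_iff_of_pos_left hs]
  by_cases h : ‖w i‖ ≤ 3 * Real.sqrt ((n : ℝ) / ℓ)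
  · simp only [h, if_true, and_true]
    by_cases hx : 0 < inner ℝ x (w i) <;> by_cases hy : 0 < inner ℝ y (w i) <;>
      simp [hx, hy, mul_pow, Real.sq_sqrt hℓ0.le]
  -- A row truncated to zero fails the strict inequalities and contributes nothing, like a point
  -- outside the ball.
  · simp only [h, if_false, and_false, inner_zero_right, lt_irrefl, zero_mul, mul_zero]

theorem WDC_of_abs_sum_coneSq_sub_le {ℓ n : ℕ} (hℓ : 0 < ℓ) (hn : 3 ≤ n) {ε : ℝ} (hε : 0 < ε)
    {w : Fin ℓ → EuclideanSpace ℝ (Fin n)}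
    (h : ∀ x y u : EuclideanSpace ℝ (Fin n), ‖x‖ = 1 → ‖y‖ = 1 → ‖u‖ = 1 →
      |∑ i, coneSq (3 * Real.sqrt n) 0 x y u (Real.sqrt ℓ • w i) -
        ℓ * ∫ g, coneSq (3 * Real.sqrt n) 0 x y u g
          ∂(stdGaussian (EuclideanSpace ℝ (Fin n)))| ≤ ε * ℓ) :
    WDC (truncMatrix w) ε (truncAlpha n) := by
  refine ⟨hε, truncAlpha_pos (by omega), truncAlpha_le_one, fun x y hx hy => ?_⟩
  have hℓ0 : (0 : ℝ) < ℓ := by exact_mod_cast hℓ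
  refine norm_toEuclideanCLM_le ((isHermitian_activeGram _ x y).sub
    ((isHermitian_QMatrix x y).smul (.all _))) hε.le fun u hu => ?_
  have := h (unitVec x) (unitVec y) u (norm_unitVec hx) (norm_unitVec hy) hu
  rw [← inner_toEuclideanCLM_activeGram hℓ, activeGram_unitVec _ hx hy,
    integral_coneSq hn (norm_unitVec hx) (norm_unitVec hy), QMatrix_unitVec hx hy, ← mul_sub,
    abs_mul, abs_of_pos hℓ0, mul_comm, mul_le_mul_iff_left₀ hℓ0] at this
  simpa only [map_sub, map_smul, sub_apply, smul_apply, inner_sub_right, real_inner_smul_right]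
    using this

/-! ### Union bound and conclusion -/

theorem hasLaw_sqrt_smul {n ℓ : ℕ} (hℓ : 0 < ℓ) {Ω : Type*} [MeasurableSpace Ω] {P : Measure Ω}
    {w : Ω → EuclideanSpace ℝ (Fin n)} (hw : HasLaw w (multivariateGaussian 0
      ((1 / (ℓ : ℝ)) • (1 : Matrix (Fin n) (Fin n) ℝ))) P) :
    HasLaw (fun ω => Real.sqrt ℓ • w ω) (stdGaussian (EuclideanSpace ℝ (Fin n))) P := by
  have hℓ0 : (0 : ℝ) < ℓ := by exact_mod_cast hℓ
  have hlaw : HasLaw (fun z : EuclideanSpace ℝ (Fin n) => Real.sqrt ℓ • z)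
      (stdGaussian (EuclideanSpace ℝ (Fin n))) (multivariateGaussian 0
      ((1 / (ℓ : ℝ)) • (1 : Matrix (Fin n) (Fin n) ℝ))) := by
    refine ⟨by fun_prop, ?_⟩
    refine Measure.ext_of_charFun ?_
    ext t
    rw [charFun_map_smul, charFun_stdGaussian, charFun_multivariateGaussian
      (Matrix.PosSemidef.one.smul (by positivity))]
    have hd : t.ofLp ⬝ᵥ t.ofLp = ‖t‖ ^ 2 := by
      rw [EuclideanSpace.real_norm_sq_eq]; simp [dotProduct, sq]
    congr 1
    simp only [inner_zero_right, Complex.ofReal_zero, zero_mul, zero_sub, WithLp.ofLp_smul,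
      Matrix.smul_mulVec, Matrix.one_mulVec, dotProduct_smul, smul_dotProduct, smul_eq_mul, hd]
    rw [show 1 / (ℓ : ℝ) * (Real.sqrt ℓ * (Real.sqrt ℓ * ‖t‖ ^ 2)) = ‖t‖ ^ 2 by
      rw [← mul_assoc (Real.sqrt ℓ), Real.mul_self_sqrt hℓ0.le]; field_simp]
    push_cast
    ring
  exact hlaw.fun_comp hw

/-- Concentration of the empirical means, uniformly over a finite set of parameters. -/
theorem measureReal_biUnion_coneSq_le {n ℓ : ℕ} {Ω : Type*} [MeasurableSpace Ω] {P : Measure Ω}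
    [IsProbabilityMeasure P] {g : Fin ℓ → Ω → EuclideanSpace ℝ (Fin n)} (hind : iIndepFun g P)
    (hg : ∀ i, HasLaw (g i) (stdGaussian (EuclideanSpace ℝ (Fin n))) P)
    {T : Finset (EuclideanSpace ℝ (Fin n))} (hT1 : ∀ t ∈ T, ‖t‖ = 1) (S : Finset ℝ) (R : ℝ)
    {ε : ℝ} (hε0 : 0 < ε) (hε1 : ε ≤ 1) :
    P.real (⋃ p ∈ T ×ˢ T ×ˢ T ×ˢ S, {ω | ε * ℓ ≤ |∑ i, coneSq R p.2.2.2 p.1 p.2.1 p.2.2.1 (g i ω) -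
      ℓ * ∫ z, coneSq R p.2.2.2 p.1 p.2.1 p.2.2.1 z
        ∂(stdGaussian (EuclideanSpace ℝ (Fin n)))|}) ≤
      (T.card : ℝ) ^ 3 * S.card * (2 * Real.exp (-(ε ^ 2 / (4 * bernsteinConst) * ℓ))) := by
  refine (measureReal_biUnion_finset_le _ _).trans ?_
  refine (Finset.sum_le_card_nsmul _ _ (2 * Real.exp (-(ε ^ 2 / (4 * bernsteinConst) * ℓ)))
    fun p hp => ?_).trans_eq ?_
  · simp only [Finset.mem_product] at hp
    have hu := hT1 _ hp.2.2.1
    exact measureReal_abs_sum_sub_ge_le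
      (X := fun i ω => coneSq R p.2.2.2 p.1 p.2.1 p.2.2.1 (g i ω))
      (Y := fun i ω => inner ℝ p.2.2.1 (g i ω))
      (hind.comp (fun _ => coneSq R p.2.2.2 p.1 p.2.1 p.2.2.1) fun _ => measurable_coneSq ..)
      (fun i => (measurable_coneSq ..).comp_aemeasurable (hg i).aemeasurable)
      (fun i => (hasLaw_inner_stdGaussian hu).fun_comp (hg i))
      (fun _ _ => coneSq_nonneg ..) (fun _ _ => coneSq_le ..)
      (fun i => (hg i).integral_comp (measurable_coneSq ..).aestronglyMeasurable) hε0 hε1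
  · simp only [Finset.card_product, nsmul_eq_mul]
    push_cast
    ring

theorem mainTheorem6 :
    ∃ (C : ℝ) (k : ℕ), 0 < C ∧ 0 < k ∧
      ∀ ε : ℝ, 0 < ε → ε < 1 →
        ∃ c γ : ℝ, 0 < c ∧ c ≤ C * ε⁻¹ ^ k ∧ 0 < γ ∧ γ⁻¹ ≤ C * ε⁻¹ ^ k ∧
          ∀ (n ℓ : ℕ), 1 ≤ n → c * (n : ℝ) * Real.log (n : ℝ) < (ℓ : ℝ) →
            ∀ (Ω : Type*) [MeasurableSpace Ω] (P : Measure Ω) [IsProbabilityMeasure P]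
              (w : Fin ℓ → Ω → EuclideanSpace ℝ (Fin n)),
              iIndepFun w P →
              (∀ i, HasLaw (w i) (multivariateGaussian 0
                ((1 / (ℓ : ℝ)) • (1 : Matrix (Fin n) (Fin n) ℝ))) P) →
              ∃ E : Set Ω, MeasurableSet E ∧
                1 - 8 * (n : ℝ) * Real.exp (-γ * (n : ℝ)) ≤ P.real E ∧
                ∀ ω ∈ E, WDC (truncMatrix fun i => w i ω) ε (truncAlpha n) := by
  have hK := four_le_bernsteinConst
  set K := bernsteinConst with hKdef
  have hK0 : 0 < K := by linarith
  refine ⟨3840 * K, 2, by positivity, two_pos, fun ε hε0 hε1 => ?_⟩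
  -- The Bernstein rate at accuracy `ε/4` is `ε²/(64K)`, and `1088 = 64 · 17`, where `17 = 3 · 5 +
  -- 2` pays for three net points and leaves `2 n log n`. The choice `3840 = 5 · 768` makes `5n/δ =
  -- γ⁻¹ n²` below.
  refine ⟨1088 * K * ε⁻¹ ^ 2, ε ^ 2 / (3840 * K), by positivity, by gcongr; norm_num,
    by positivity, by rw [inv_div, inv_pow, div_eq_mul_inv], ?_⟩
  intro n ℓ hn hℓ Ω _ P _ w hind hlaw
  have hn1 : (1 : ℝ) ≤ n := by exact_mod_cast hn
  have hn0 : (0 : ℝ) < n := by linarith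
  set γ : ℝ := ε ^ 2 / (3840 * K) with hγ
  have hγ0 : 0 < γ := by positivity
  have hγ1 : γ ≤ 1 / 3840 := by
    rw [hγ, div_le_div_iff₀ (by positivity) (by norm_num)]
    nlinarith
  -- Here `8 n exp (-γ n) ≥ 8/e > 1`, so the empty event suffices. This disposes of all small `n`,
  -- and afterwards `γ⁻¹ < n` is available.
  by_cases hsmall : γ * n ≤ 1
  · refine ⟨∅, .empty, ?_, by simp⟩
    have h1 : Real.exp (-1) ≤ Real.exp (-γ * n) := Real.exp_le_exp.2 (by linarith)
    have h2 : (0.36 : ℝ) < Real.exp (-1) := by linarith [Real.exp_neg_one_gt_d9]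
    simp only [measureReal_empty]
    nlinarith [mul_le_mul_of_nonneg_right hn1 (Real.exp_pos (-γ * n)).le]
  push Not at hsmall
  have hn3840 : (3840 : ℝ) < n := by nlinarith
  have hn3 : 3 ≤ n := by
    have : (3 : ℝ) ≤ n := by linarith
    exact_mod_cast this
  have hlog : 1 / 2 ≤ Real.log n := by
    have := Real.log_le_log two_pos (by linarith : (2 : ℝ) ≤ n)
    linarith [Real.log_two_gt_d9]
  have hℓ0' : (0 : ℝ) < ℓ := lt_of_le_of_lt (by positivity) hℓ
  have hℓ0 : 0 < ℓ := by exact_mod_cast hℓ0'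
  set δ : ℝ := ε ^ 2 / (768 * K * n) with hδ
  have hδ0 : 0 < δ := by positivity
  have hδ1 : δ ≤ 1 := by
    rw [hδ, div_le_one (by positivity)]
    nlinarith
  obtain ⟨T, hT1, hTcard, hT⟩ := exists_finset_sphere_net hn hδ0 hδ1
  have hcard : (T.card : ℝ) ≤ Real.exp (5 * n * Real.log n) := by
    have h1 : 5 * n / δ ≤ (n : ℝ) ^ 5 := by
      have h2 : 5 * n / δ = γ⁻¹ * n ^ 2 := by
        rw [hγ, hδ]; field_simp; norm_num
      have h3 : γ⁻¹ ≤ n := by rw [inv_le_iff_one_le_mul₀' hγ0]; exact hsmall.le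
      rw [h2]
      calc γ⁻¹ * (n : ℝ) ^ 2 ≤ n * n ^ 2 := by gcongr
        _ = (n : ℝ) ^ 3 := by ring
        _ ≤ (n : ℝ) ^ 5 := pow_le_pow_right₀ hn1 (by norm_num)
    calc (T.card : ℝ) ≤ (5 * n / δ) ^ n := hTcard
      _ ≤ ((n : ℝ) ^ 5) ^ n := by gcongr
      _ = Real.exp (Real.log n) ^ (5 * n) := by rw [Real.exp_log hn0, pow_mul]
      _ = _ := by rw [← Real.exp_nat_mul]; push_cast; rfl
  set g : Fin ℓ → Ω → EuclideanSpace ℝ (Fin n) := fun i ω => Real.sqrt ℓ • w i ω with hg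
  have hgind : iIndepFun g P :=
    hind.comp (fun _ z => Real.sqrt ℓ • z) fun _ => measurable_const_smul _
  have hglaw := fun i => hasLaw_sqrt_smul hℓ0 (hlaw i)
  set S : Finset ℝ := {3 * Real.sqrt n * δ, -(3 * Real.sqrt n * δ)} with hS
  have hScard : (S.card : ℝ) ≤ 2 := by exact_mod_cast Finset.card_le_two
  have hbad := measureReal_biUnion_coneSq_le hgind hglaw hT1 S (3 * Real.sqrt n)
    (ε := ε / 4) (by positivity) (by linarith)
  set B := ⋃ p ∈ T ×ˢ T ×ˢ T ×ˢ S, {ω | ε / 4 * ℓ ≤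
    |∑ i, coneSq (3 * Real.sqrt n) p.2.2.2 p.1 p.2.1 p.2.2.1 (g i ω) -
      ℓ * ∫ z, coneSq (3 * Real.sqrt n) p.2.2.2 p.1 p.2.1 p.2.2.1 z
        ∂(stdGaussian (EuclideanSpace ℝ (Fin n)))|} with hB
  -- The `w i` are only almost everywhere measurable, so `B` need not be measurable; its measurable
  -- hull has the same probability.
  refine ⟨(toMeasurable P B)ᶜ, (measurableSet_toMeasurable P B).compl, ?_, fun ω hω => ?_⟩
  · rw [probReal_compl_eq_one_sub (measurableSet_toMeasurable P B), measureReal_def,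
      measure_toMeasurable, ← measureReal_def]
    have hexp : 17 * n * Real.log n ≤ (ε / 4) ^ 2 / (4 * K) * ℓ := by
      calc 17 * n * Real.log n =
          (ε / 4) ^ 2 / (4 * K) * (1088 * K * ε⁻¹ ^ 2 * n * Real.log n) := by
            field_simp; norm_num
        _ ≤ _ := by gcongr
    have h1 : P.real B ≤ 4 * Real.exp (-γ * n) := by
      calc P.real B ≤ _ := hbad
        _ ≤ Real.exp (5 * n * Real.log n) ^ 3 * 2 * (2 * Real.exp (-(17 * n * Real.log n))) := by
          gcongr
        _ = 4 * Real.exp (-(2 * n * Real.log n)) := by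
          rw [show -(2 * n * Real.log n) = (3 : ℕ) * (5 * n * Real.log n) +
            -(17 * n * Real.log n) by push_cast; ring, Real.exp_add, Real.exp_nat_mul]
          ring
        _ ≤ _ := by
          -- Since `log n ≥ 1/2`, the right side is at least `n`, while `γ < 1`.
          have : γ * n ≤ 2 * n * Real.log n := by nlinarith
          gcongr
          linarith
    nlinarith [Real.exp_pos (-γ * n)]
  · have hωB : ω ∉ B := fun h => hω (subset_toMeasurable P B h)
    refine WDC_of_abs_sum_coneSq_sub_le hℓ0 hn3 hε0 fun x y u hx hy hu => ?_
    refine abs_sum_coneSq_sub_le_of_net hn hε0 hε1.le hδ hT1 hT (fun x hx y hy u hu τ hτ => ?_)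
      hx hy hu
    by_contra! hcon
    have hmem : (x, y, u, τ) ∈ T ×ˢ T ×ˢ T ×ˢ S := by
      simp only [Finset.mem_product]
      exact ⟨hx, hy, hu, hτ⟩
    exact hωB (Set.mem_iUnion₂.2 ⟨_, hmem, hcon.le⟩)
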